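/- Theorem 1.2 (Comparison theorem for SLLN). Let $(\Omega,\mathcal F,\mathbb P)$ be a probability space and let $(\mathbf B,\|\cdot\|)$ be a real separable Banach space with its Borel $\sigma$-algebra; all random variables are defined on $\Omega$. Let $\{a_n; n\ge 1\}$ and $\{b_n; n\ge 1\}$ be increasing (not necessarily strictly) sequences of positive real numbers such that $\lim_{n\to\infty}a_n=\infty$ and $\{b_n/a_n; n\ge1\}$ is nondecreasing. For a sequence $\{X,X_n; n\ge 1\}$ of i.i.d. $\mathbf B$-valued random variables, where $X$ denotes a generic variable with the common law, put $$S_n=\sum_{i=1}^nX_i,\qquad \gamma_n=n\,\mathbb E\left(X I\{\|X\|\le b_n\}\right),\qquad n\ge1;$$ the sequence is called symmetric if $X$ and $-X$ have the same law. Suppose that, for every symmetric sequence $\{X,X_n; n\ge1\}$ of i.i.d. $\mathbf B$-valued random variables, $$\lim_{n\to\infty}\frac{S_n}{a_n}=0\ \text{ a.s. if and only if }\ \sum_{n=1}^\infty\mathbb P(\|X\|>a_n)<\infty .$$ Then, for every sequence $\{X,X_n; n\ge1\}$ of i.i.d. $\mathbf B$-valued random variables (not necessarily symmetric), $$\lim_{n\to\infty}\frac{S_n-\gamma_n}{b_n}=0\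 \text{ a.s. if }\ \sum_{n=1}^\infty\mathbb P(\|X\|>b_n)<\infty,$$ and $$\limsup_{n\to\infty}\frac{\|S_n-\gamma_n\|}{b_n}=\infty\ \text{ a.s. if }\ \sum_{n=1}^\infty\mathbb P(\|X\|>b_n)=\infty .$$ -/

import Mathlib

open MeasureTheory ProbabilityTheory Filter Topology

noncomputable section

/-- `X 0, X 1, X 2, …` (playing the role of `X₁, X₂, X₃, …`) are independent and identically
distributed `B`-valued random variables on the probability space `(Ω, P)`.  Every `X n` has the
law of the generic variable `X 0`. -/
structure IsIIDSeq {Ω B : Type*} [MeasurableSpace Ω] [MeasurableSpace B]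
    (P : Measure Ω) (X : ℕ → Ω → B) : Prop where
  measurable : ∀ n, Measurable (X n)
  indep : iIndepFun X P
  identDistrib : ∀ n, IdentDistrib (X n) (X 0) P P

/-- A symmetric i.i.d. sequence: i.i.d., and the common law is invariant under `x ↦ -x`. -/
structure IsSymmIIDSeq {Ω B : Type*} [MeasurableSpace Ω] [MeasurableSpace B] [Neg B]
    (P : Measure Ω) (X : ℕ → Ω → B) : Prop extends IsIIDSeq P X where
  symm : IdentDistrib (fun ω => -X 0 ω) (X 0) P P

/-- `S n = X₁ + ⋯ + X_n`, the sum of the first `n` members of the sequence. -/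
def partialSum {Ω B : Type*} [AddCommMonoid B] (X : ℕ → Ω → B) (n : ℕ) (ω : Ω) : B :=
  ∑ i ∈ Finset.range n, X i ω

/-- `γ_n = n 𝔼(X 𝟙{‖X‖ ≤ b_n})`.  The integrand is bounded. -/
def truncCenter {Ω B : Type*} [MeasurableSpace Ω] [NormedAddCommGroup B] [NormedSpace ℝ B]
    (P : Measure Ω) (b : ℕ → ℝ) (X : ℕ → Ω → B) (n : ℕ) : B :=
  (n : ℝ) • ∫ ω, Set.indicator {ω | ‖X 0 ω‖ ≤ b n} (X 0) ω ∂P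

/-- `∑_{n ≥ 1} P(‖X‖ > c_n)`, as an element of `[0, ∞]`. -/
def tailSeries {Ω B : Type*} [MeasurableSpace Ω] [Norm B]
    (P : Measure Ω) (c : ℕ → ℝ) (X : ℕ → Ω → B) : ENNReal :=
  ∑' n : ℕ, P {ω | c (n + 1) < ‖X 0 ω‖}

end

/-! ### Sign changes: a combinatorial reflection principle. -/

section Signs

variable {ι B : Type*}

/-! For symmetric variables, compare the two normalisations by shrinking. Let `g r` be the ratio `a
/ b` at the first index where `b` reaches `r`, and let φ(x) = g(‖x‖)x. Since `a / b` is
nonincreasing and `a` is nondecreasing, ‖x‖ ≤ b_n forces ‖φ(x)‖ ≤ a_n. So the tail condition for X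
at the levels b_n gives the one for φ(X) at a_n, and the hypothesis yields the strong law for φ(X)
with norming `a`. To return to X, cut the indices into blocks along which `b` doubles. Block sums of
the truncated φ(X_i) are independent and o(a), so the second Borel-Cantelli lemma makes their
large-deviation probabilities summable. Within a block, (a/b at its last index)/g is an even weight
in [0, 1]. The contraction principle therefore transfers summability to the X_i, Lévy's inequality
passes to maxima within blocks, and the first Borel-Cantelli lemma with a geometric sum concludes
(`symmetric_slln_comparison`).

For a general sequence, symmetrise by X_{2n} - X_{2n+1}. Rescaling makes one convergent tail series
imply the strong law and convergence at every level (`tsum_lt_top_of_slln`), and the tails of X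
inherit this. Freezing one of two independent copies by Fubini gives deterministic centers
(`exists_center_of_pairDiff`). The Hoffmann-Jørgensen inequality bounds mean norms of truncated
symmetrised sums, so Jensen and Markov identify these centers with truncated means up to o(b)
(`centered_slln`).

For divergence, a finite limsup with positive probability would hold simultaneously for the even and
odd subsequences. Their centers cancel in the difference, so the symmetrised terms are O(b) with
positive probability. Borel-Cantelli and the same rescaling then make the tail series of X converge.
-/

/-- Change the sign of the coordinates of `y` marked by `σ`. -/
def signFlip [Neg B] (σ : ι → Bool) (y : ι → B) : ι → B :=
  fun i => if σ i then -y i else y i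

theorem signFlip_eq_self_or_neg [Neg B] (σ : ι → Bool) (y : ι → B) (i : ι) :
    signFlip σ y i = y i ∨ signFlip σ y i = -y i := by
  unfold signFlip
  split <;> simp

variable [Fintype ι]

open Classical in
/-- The reflection argument behind Lévy's maximal inequality: among all choices of signs, a sum
over some member of a chain of index sets is large at most twice as often as the full sum. -/
theorem card_signs_exists_sum_gt_le [NormedAddCommGroup B] [NormedSpace ℝ B]
    {C : Set (Finset ι)} (hC : IsChain (· ⊆ ·) C) (y : ι → B) (t : ℝ) :
    (Finset.univ.filter fun σ : ι → Bool => ∃ A ∈ C, t < ‖∑ i ∈ A, signFlip σ y i‖).card ≤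
      2 * (Finset.univ.filter fun σ : ι → Bool => t < ‖∑ i, signFlip σ y i‖).card := by
  set E := Finset.univ.filter fun σ : ι → Bool => ∃ A ∈ C, t < ‖∑ i ∈ A, signFlip σ y i‖
  set G := Finset.univ.filter fun σ : ι → Bool => t < ‖∑ i, signFlip σ y i‖
  -- The least large member of the chain plays the part of a stopping time.
  have hmin : ∀ σ : ι → Bool, ∃ A : Finset ι, σ ∈ E → (A ∈ C ∧ t < ‖∑ i ∈ A, signFlip σ y i‖ ∧
      ∀ A' ∈ C, t < ‖∑ i ∈ A', signFlip σ y i‖ → A ⊆ A') := by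
    intro σ
    by_cases hσ : σ ∈ E
    · have hne : {A : Finset ι | A ∈ C ∧ t < ‖∑ i ∈ A, signFlip σ y i‖}.Nonempty := by
        obtain ⟨A, hA⟩ := (Finset.mem_filter.1 hσ).2
        exact ⟨A, hA⟩
      obtain ⟨A, hA, hAmin⟩ := WellFounded.has_min (wellFounded_lt (α := Finset ι)) _ hne
      refine ⟨A, fun _ => ⟨hA.1, hA.2, fun A' hA' ht => ?_⟩⟩
      rcases hC.total hA.1 hA' with h | h
      · exact h
      · by_contra hn
        exact hAmin A' ⟨hA', ht⟩ (lt_of_le_of_ne h (fun he => hn (he ▸ subset_rfl)))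
    · exact ⟨∅, fun h => absurd h hσ⟩
  choose A hA using hmin
  -- Reflection after stopping: reverse exactly the signs outside `A σ`.
  let R : (ι → Bool) → (ι → Bool) := fun σ i => if i ∈ A σ then σ i else !(σ i)
  have hRin : ∀ σ i, i ∈ A σ → signFlip (R σ) y i = signFlip σ y i := by
    intro σ i hi
    simp [signFlip, R, hi]
  have hRout : ∀ σ i, i ∉ A σ → signFlip (R σ) y i = -signFlip σ y i := by
    intro σ i hi
    by_cases h : σ i <;> simp [signFlip, R, hi, h]
  have hsub : ∀ σ A', A' ⊆ A σ → ∑ i ∈ A', signFlip (R σ) y i = ∑ i ∈ A', signFlip σ y i :=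
    fun σ A' h => Finset.sum_congr rfl fun i hi => hRin σ i (h hi)
  have hRE : ∀ σ ∈ E, R σ ∈ E := fun σ hσ =>
    Finset.mem_filter.2 ⟨Finset.mem_univ _, A σ, (hA σ hσ).1, by
      rw [hsub σ _ subset_rfl]; exact (hA σ hσ).2.1⟩
  -- Signs inside `A σ` are untouched, so minimality in both directions fixes the stopping set;
  -- hence `R` is an involution on `E`.
  have hAR : ∀ σ ∈ E, A (R σ) = A σ := by
    intro σ hσ
    have h1 : A (R σ) ⊆ A σ := (hA _ (hRE σ hσ)).2.2 _ (hA σ hσ).1 (by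
      rw [hsub σ _ subset_rfl]; exact (hA σ hσ).2.1)
    refine subset_antisymm h1 ((hA σ hσ).2.2 _ (hA _ (hRE σ hσ)).1 ?_)
    rw [← hsub σ _ h1]
    exact (hA _ (hRE σ hσ)).2.1
  have hRR : ∀ σ ∈ E, R (R σ) = σ := by
    intro σ hσ
    funext i
    change (if i ∈ A (R σ) then R σ i else !(R σ i)) = σ i
    rw [hAR σ hσ]
    by_cases hi : i ∈ A σ <;> simp [R, hi]
  have hcover : E ⊆ G ∪ (E.filter fun σ => R σ ∈ G) := by
    intro σ hσ
    by_contra hn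
    simp only [Finset.mem_union, Finset.mem_filter, not_or, not_and] at hn
    have h1 : ‖∑ i, signFlip σ y i‖ ≤ t := by
      have := hn.1
      simpa [G] using this
    have h2 : ‖∑ i, signFlip (R σ) y i‖ ≤ t := by
      have := hn.2 hσ
      simpa [G] using this
    -- The contributions outside `A σ` cancel, so the full sum and its reflection cannot both have
    -- norm at most `t`.
    have h3 : (∑ i, signFlip σ y i) + ∑ i, signFlip (R σ) y i
        = (2 : ℝ) • ∑ i ∈ A σ, signFlip σ y i := by
      rw [← Finset.sum_add_distrib, ← Finset.sum_subset (Finset.subset_univ (A σ)), Finset.smul_sum]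
      · exact Finset.sum_congr rfl fun i hi => by rw [hRin σ i hi, two_smul]
      · intro i _ hi
        rw [hRout σ i hi, add_neg_cancel]
    have h4 := norm_add_le (∑ i, signFlip σ y i) (∑ i, signFlip (R σ) y i)
    rw [h3, norm_smul] at h4
    have h5 := (hA σ hσ).2.1
    norm_num at h4
    linarith
  calc E.card ≤ (G ∪ (E.filter fun σ => R σ ∈ G)).card := Finset.card_le_card hcover
    _ ≤ G.card + (E.filter fun σ => R σ ∈ G).card := Finset.card_union_le _ _
    _ ≤ G.card + G.card := by
        refine Nat.add_le_add_left ?_ _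
        refine Finset.card_le_card_of_injOn R (fun σ hσ => (Finset.mem_filter.1 hσ).2) ?_
        intro σ hσ τ hτ h
        rw [← hRR σ (Finset.mem_filter.1 hσ).1, h, hRR τ (Finset.mem_filter.1 hτ).1]
    _ = 2 * G.card := by ring

/-- A sum with weights in `[0, 1]` is an average of sums over the superlevel sets of the
weights. -/
theorem exists_superlevel_sum_gt [NormedAddCommGroup B] [NormedSpace ℝ B] [CompleteSpace B] {θ : ι → ℝ}
    (h0 : ∀ i, 0 ≤ θ i) (h1 : ∀ i, θ i ≤ 1) (v : ι → B) {t : ℝ} (ht : t < ‖∑ i, θ i • v i‖) :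
    ∃ s : ℝ, t < ‖∑ i ∈ Finset.univ.filter (fun i => s ≤ θ i), v i‖ := by
  by_contra! hn
  -- Layer cake: a weight in `[0, 1]` is the length of the set of levels below it.
  have hterm : ∀ i, ∫ s in Set.Ioc (0 : ℝ) 1, (Set.Iic (θ i)).indicator (fun _ => v i) s
      = θ i • v i := by
    intro i
    rw [setIntegral_indicator measurableSet_Iic, setIntegral_const]
    have : Set.Ioc (0 : ℝ) 1 ∩ Set.Iic (θ i) = Set.Ioc 0 (θ i) := by
      ext s
      simp only [Set.mem_inter_iff, Set.mem_Ioc, Set.mem_Iic]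
      exact ⟨fun h => ⟨h.1.1, h.2⟩, fun h => ⟨⟨h.1, h.2.trans (h1 i)⟩, h.2⟩⟩
    rw [this]
    simp [Measure.real, h0 i]
  have hint : ∀ i ∈ (Finset.univ : Finset ι), Integrable
      (fun s : ℝ => (Set.Iic (θ i)).indicator (fun _ => v i) s)
      (volume.restrict (Set.Ioc (0 : ℝ) 1)) := fun i _ =>
    (integrable_const (v i)).indicator measurableSet_Iic
  have hsum : ∑ i, θ i • v i
      = ∫ s in Set.Ioc (0 : ℝ) 1, ∑ i, (Set.Iic (θ i)).indicator (fun _ => v i) s := by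
    rw [integral_finsetSum _ hint]
    exact Finset.sum_congr rfl fun i _ => (hterm i).symm
  have hle : ‖∑ i, θ i • v i‖ ≤ t * (volume : Measure ℝ).real (Set.Ioc (0 : ℝ) 1) := by
    rw [hsum]
    refine norm_setIntegral_le_of_norm_le_const (by simp) fun s _ => ?_
    have := hn s
    rw [Finset.sum_filter] at this
    simpa [Set.indicator_apply] using this
  simp at hle
  linarith

-- Superlevel sets of a weight are nested, so the reflection bound covers all of them at once.
open Classical in
theorem card_signs_weighted_sum_gt_le [NormedAddCommGroup B] [NormedSpace ℝ B] [CompleteSpace B]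
    {θ : ι → ℝ} (h0 : ∀ i, 0 ≤ θ i) (h1 : ∀ i, θ i ≤ 1) (y : ι → B) (t : ℝ) :
    (Finset.univ.filter fun σ : ι → Bool => t < ‖∑ i, θ i • signFlip σ y i‖).card ≤
      2 * (Finset.univ.filter fun σ : ι → Bool => t < ‖∑ i, signFlip σ y i‖).card := by
  let C : Set (Finset ι) := Set.range fun s : ℝ => Finset.univ.filter fun i => s ≤ θ i
  have hC : IsChain (· ⊆ ·) C := by
    rintro _ ⟨s, rfl⟩ _ ⟨s', rfl⟩ _
    rcases le_total s s' with h | h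
    · exact Or.inr (Finset.monotone_filter_right _ fun i _ hi => h.trans hi)
    · exact Or.inl (Finset.monotone_filter_right _ fun i _ hi => h.trans hi)
  refine le_trans (Finset.card_le_card ?_) (card_signs_exists_sum_gt_le hC y t)
  refine Finset.monotone_filter_right _ fun σ _ hσ => ?_
  obtain ⟨s, hs⟩ := exists_superlevel_sum_gt h0 h1 _ hσ
  exact ⟨_, ⟨s, rfl⟩, hs⟩

end Signs

/-! ### Lévy and contraction inequalities for independent symmetric variables. -/

section Symmetric

variable {Ω ι B : Type*} [MeasurableSpace Ω] {P : Measure Ω} [Fintype ι]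
  [NormedAddCommGroup B] [MeasurableSpace B] [BorelSpace B] {X : ι → Ω → B}

theorem measurable_signFlip {ι : Type*} (σ : ι → Bool) : Measurable (signFlip (B := B) σ) := by
  refine measurable_pi_lambda _ fun i => ?_
  unfold signFlip
  have hm : Measurable fun y : ι → B => y i := measurable_pi_apply i
  by_cases h : σ i
  · simp only [h, if_true]
    exact hm.neg
  · simpa [h] using hm

/-- The joint law is a product of symmetric marginals, so each coordinate may be reflected
separately. -/
theorem map_signFlip_eq (hX : ∀ i, Measurable (X i)) (hind : iIndepFun X P)
    (hsymm : ∀ i, IdentDistrib (fun ω => -X i ω) (X i) P P) (σ : ι → Bool) :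
    P.map (fun ω => signFlip σ fun i => X i ω) = P.map (fun ω i => X i ω) := by
  have := hind.isProbabilityMeasure
  let g : ι → B → B := fun i x => if σ i then -x else x
  have hg : ∀ i, Measurable (g i) := fun i => by
    by_cases h : σ i
    · simpa [g, h] using measurable_neg
    · simpa [g, h] using measurable_id'
  have h1 := (hind.comp g hg).map_fun_eq_pi_map
    fun i => ((hg i).comp (hX i)).aemeasurable
  have h2 := hind.map_fun_eq_pi_map fun i => (hX i).aemeasurable
  have h3 : ∀ i, P.map (g i ∘ X i) = P.map (X i) := fun i => by
    by_cases h : σ i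
    · simpa [g, h, Function.comp_def] using (hsymm i).map_eq
    · simp [g, h, Function.comp_def]
  rw [h2, ← funext h3, ← h1]
  rfl

open Classical in
/-- An inequality between numbers of sign choices, valid for every vector, passes to the
probabilities for independent symmetric random variables. -/
theorem measure_le_two_mul_of_card_signs_le (hX : ∀ i, Measurable (X i)) (hind : iIndepFun X P)
    (hsymm : ∀ i, IdentDistrib (fun ω => -X i ω) (X i) P P) {F G : Set (ι → B)}
    (hF : MeasurableSet F) (hG : MeasurableSet G)
    (hFG : ∀ y : ι → B, (Finset.univ.filter fun σ : ι → Bool => signFlip σ y ∈ F).card ≤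
      2 * (Finset.univ.filter fun σ : ι → Bool => signFlip σ y ∈ G).card) :
    P {ω | (fun i => X i ω) ∈ F} ≤ 2 * P {ω | (fun i => X i ω) ∈ G} := by
  have hXm : Measurable fun ω i => X i ω := measurable_pi_lambda _ hX
  -- By sign invariance every sign choice contributes the same probability to the mean count.
  have key : ∀ H : Set (ι → B), MeasurableSet H →
      ∫⁻ ω, ((Finset.univ.filter fun σ : ι → Bool => signFlip σ (fun i => X i ω) ∈ H).card : ENNReal)
        ∂P = (Fintype.card (ι → Bool) : ENNReal) * P {ω | (fun i => X i ω) ∈ H} := by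
    intro H hH
    have hpre : ∀ σ : ι → Bool, MeasurableSet {ω | signFlip σ (fun i => X i ω) ∈ H} := fun σ =>
      ((measurable_signFlip σ).comp hXm) hH
    have e1 : ∀ ω, ((Finset.univ.filter fun σ : ι → Bool =>
        signFlip σ (fun i => X i ω) ∈ H).card : ENNReal)
        = ∑ σ : ι → Bool, {ω | signFlip σ (fun i => X i ω) ∈ H}.indicator 1 ω := by
      intro ω
      rw [Finset.card_filter]
      push_cast
      exact Finset.sum_congr rfl fun σ _ => by simp [Set.indicator_apply]
    simp_rw [e1]
    rw [lintegral_finsetSum _ fun σ _ => (measurable_one.indicator (hpre σ))]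
    have e2 : ∀ σ : ι → Bool, ∫⁻ ω, {ω | signFlip σ (fun i => X i ω) ∈ H}.indicator 1 ω ∂P
        = P {ω | (fun i => X i ω) ∈ H} := by
      intro σ
      rw [lintegral_indicator_one (hpre σ)]
      have : P.map (fun ω => signFlip σ fun i => X i ω) H = P.map (fun ω i => X i ω) H := by
        rw [map_signFlip_eq hX hind hsymm σ]
      have hm : Measurable fun ω => signFlip σ fun i => X i ω := (measurable_signFlip σ).comp hXm
      rw [Measure.map_apply hm hH,
        Measure.map_apply hXm hH] at this
      exact this
    simp_rw [e2]
    simp [Fintype.card_pi]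
  have hle : ∫⁻ ω, ((Finset.univ.filter fun σ : ι → Bool =>
        signFlip σ (fun i => X i ω) ∈ F).card : ENNReal) ∂P
      ≤ ∫⁻ ω, 2 * ((Finset.univ.filter fun σ : ι → Bool =>
        signFlip σ (fun i => X i ω) ∈ G).card : ENNReal) ∂P :=
    lintegral_mono fun ω => by
      have := hFG fun i => X i ω
      simp only
      rw [← Nat.cast_ofNat, ← Nat.cast_mul]
      exact Nat.cast_le.2 this
  rw [lintegral_const_mul' _ _ (by simp), key F hF, key G hG, mul_left_comm] at hle
  exact (ENNReal.mul_le_mul_iff_right (by simp) (by simp)).1 hle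

variable [NormedSpace ℝ B] [SecondCountableTopology B]

theorem levy_chain_inequality (hX : ∀ i, Measurable (X i)) (hind : iIndepFun X P)
    (hsymm : ∀ i, IdentDistrib (fun ω => -X i ω) (X i) P P) {C : Set (Finset ι)}
    (hC : IsChain (· ⊆ ·) C) (t : ℝ) :
    P {ω | ∃ A ∈ C, t < ‖∑ i ∈ A, X i ω‖} ≤ 2 * P {ω | t < ‖∑ i, X i ω‖} := by
  have hm : ∀ A : Finset ι, MeasurableSet {y : ι → B | t < ‖∑ i ∈ A, y i‖} := fun A =>
    measurableSet_lt measurable_const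
      (Finset.measurable_sum _ fun i _ => measurable_pi_apply i).norm
  refine measure_le_two_mul_of_card_signs_le hX hind hsymm
    (F := {y | ∃ A ∈ C, t < ‖∑ i ∈ A, y i‖}) (G := {y | t < ‖∑ i, y i‖}) ?_ (hm _) fun y => ?_
  · have : {y : ι → B | ∃ A ∈ C, t < ‖∑ i ∈ A, y i‖} = ⋃ A ∈ C, {y | t < ‖∑ i ∈ A, y i‖} := by
      ext; simp
    rw [this]
    exact MeasurableSet.biUnion C.to_countable fun A _ => hm A
  · convert card_signs_exists_sum_gt_le hC y t using 3 <;> rfl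

/-- The contraction principle for tail probabilities: odd functions of the variables may be
multiplied by even functions of them with values in `[0, 1]`. -/
theorem contraction_inequality [CompleteSpace B] (hX : ∀ i, Measurable (X i))
    (hind : iIndepFun X P) (hsymm : ∀ i, IdentDistrib (fun ω => -X i ω) (X i) P P)
    {θ : ι → B → ℝ} {v : ι → B → B}
    (hθ : ∀ i, Measurable (θ i)) (h0 : ∀ i x, 0 ≤ θ i x) (h1 : ∀ i x, θ i x ≤ 1)
    (heven : ∀ i x, θ i (-x) = θ i x) (hv : ∀ i, Measurable (v i))
    (hodd : ∀ i x, v i (-x) = -v i x) (t : ℝ) :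
    P {ω | t < ‖∑ i, θ i (X i ω) • v i (X i ω)‖} ≤ 2 * P {ω | t < ‖∑ i, v i (X i ω)‖} := by
  refine measure_le_two_mul_of_card_signs_le hX hind hsymm
    (F := {y | t < ‖∑ i, θ i (y i) • v i (y i)‖}) (G := {y | t < ‖∑ i, v i (y i)‖}) ?_ ?_ fun y => ?_
  · exact measurableSet_lt measurable_const (Finset.measurable_sum _ fun i _ =>
      ((hθ i).comp (measurable_pi_apply i)).smul ((hv i).comp (measurable_pi_apply i))).norm
  · exact measurableSet_lt measurable_const
      (Finset.measurable_sum _ fun i _ => (hv i).comp (measurable_pi_apply i)).norm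
  -- Flipping signs leaves the even weights fixed and flips only the vectors, so the weights are
  -- constants for the counting bound.
  · have hvf : ∀ (σ : ι → Bool) i, v i (signFlip σ y i) = signFlip σ (fun j => v j (y j)) i := by
      intro σ i
      by_cases h : σ i <;> simp [signFlip, h, hodd]
    have hθf : ∀ (σ : ι → Bool) i, θ i (signFlip σ y i) = θ i (y i) := fun σ i => by
      rcases signFlip_eq_self_or_neg σ y i with h | h <;> rw [h]
      exact heven i _
    simp only [Set.mem_ofPred_eq, hvf, hθf]
    convert card_signs_weighted_sum_gt_le (fun i => h0 i (y i)) (fun i => h1 i (y i))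
      (fun j => v j (y j)) t using 3

end Symmetric

/-! ### Independence of disjoint groups and the converse Borel-Cantelli argument. -/

section Grouping

variable {Ω : Type*} [MeasurableSpace Ω] {P : Measure Ω}

/-- Disjoint groups of independent variables are independent. -/
theorem iIndepFun_curry {ι β : Type*} {κ : ι → Type*} [MeasurableSpace β]
    {X : (Σ i, κ i) → Ω → β} (hX : ∀ p, Measurable (X p)) (hind : iIndepFun X P) :
    iIndepFun (fun i ω (j : κ i) => X ⟨i, j⟩ ω) P := by
  have := hind.isProbabilityMeasure
  have hprob : ∀ i j, IsProbabilityMeasure (P.map (X ⟨i, j⟩)) :=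
    fun i j => Measure.isProbabilityMeasure_map (hX ⟨i, j⟩).aemeasurable
  have hfib : ∀ i, iIndepFun (fun j : κ i => X ⟨i, j⟩) P := fun i =>
    hind.precomp (g := fun j : κ i => (⟨i, j⟩ : Σ i, κ i)) sigma_mk_injective
  rw [iIndepFun_iff_map_fun_eq_infinitePi_map
    (fun i => measurable_pi_lambda _ fun j => hX ⟨i, j⟩)]
  have h1 := hind.map_fun_eq_infinitePi_map hX
  have h2 := Measure.infinitePi_map_piCurry (X := fun (i : ι) (_ : κ i) => β)
    (fun i j => P.map (X ⟨i, j⟩))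
  have h3 : ∀ i, P.map (fun ω (j : κ i) => X ⟨i, j⟩ ω)
      = Measure.infinitePi fun j => P.map (X ⟨i, j⟩) := fun i =>
    (hfib i).map_fun_eq_infinitePi_map fun j => hX ⟨i, j⟩
  rw [funext h3, ← h2]
  have h4 : (Measure.infinitePi fun p : Σ i, κ i => P.map (X ⟨p.1, p.2⟩))
      = P.map fun ω p => X p ω := h1.symm
  rw [h4, Measure.map_map (MeasurableEquiv.measurable _) (measurable_pi_lambda _ hX)]
  rfl

/-- An injective `e` lists disjoint groups; it serves the dyadic blocks, the consecutive pairs and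
the even/odd split. -/
theorem iIndepFun_groups {ι α β : Type*} {κ : ι → Type*} [MeasurableSpace β]
    {X : α → Ω → β} (hX : ∀ a, Measurable (X a)) (hind : iIndepFun X P) {e : (Σ i, κ i) → α}
    (he : Function.Injective e) :
    iIndepFun (fun i ω (j : κ i) => X (e ⟨i, j⟩) ω) P :=
  iIndepFun_curry (fun p => hX (e p)) (hind.precomp he)

theorem iIndepSet_preimage {ι : Type*} {β : ι → Type*} [∀ i, MeasurableSpace (β i)]
    {X : ∀ i, Ω → β i} (hind : iIndepFun X P) (hX : ∀ i, Measurable (X i)) {s : ∀ i, Set (β i)}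
    (hs : ∀ i, MeasurableSet (s i)) : iIndepSet (fun i => X i ⁻¹' s i) P := by
  rw [iIndepSet_iff_meas_biInter fun i => hX i (hs i)]
  exact fun t => hind.meas_biInter fun i _ => ⟨s i, hs i, rfl⟩

/-- Contrapositive form of the second Borel-Cantelli lemma. -/
theorem tsum_measure_lt_top_of_ae_eventually_notMem [IsProbabilityMeasure P] {s : ℕ → Set Ω}
    (hs : iIndepSet s P) (hsm : ∀ n, MeasurableSet (s n))
    (h : ∃ᵐ ω ∂P, ∀ᶠ n in atTop, ω ∉ s n) : ∑' n, P (s n) < ⊤ := by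
  by_contra hn
  have h1 := measure_limsup_eq_one hsm hs (not_lt_top_iff.1 hn)
  have h2 : ∀ᵐ ω ∂P, ω ∈ limsup s atTop :=
    (mem_ae_iff_prob_eq_one (MeasurableSet.measurableSet_limsup hsm)).2 h1
  refine h (h2.mono fun ω hω hev => ?_)
  rw [mem_limsup_iff_frequently_mem] at hω
  exact hω hev

end Grouping

/-! ### The symmetric inequalities over finite subsets of an index type. -/

section SymmetricFinset

variable {Ω ι B : Type*} [MeasurableSpace Ω] {P : Measure Ω}
  [NormedAddCommGroup B] [NormedSpace ℝ B] [MeasurableSpace B] [BorelSpace B]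
  [SecondCountableTopology B] {X : ι → Ω → B}

theorem levy_chain_inequality_finset (hX : ∀ i, Measurable (X i)) (hind : iIndepFun X P)
    (hsymm : ∀ i, IdentDistrib (fun ω => -X i ω) (X i) P P) (s : Finset ι)
    {C : Set (Finset ι)} (hC : IsChain (· ⊆ ·) C) (hCs : ∀ A ∈ C, A ⊆ s) (t : ℝ) :
    P {ω | ∃ A ∈ C, t < ‖∑ i ∈ A, X i ω‖} ≤ 2 * P {ω | t < ‖∑ i ∈ s, X i ω‖} := by
  classical
  have hC' : IsChain (· ⊆ ·) ((fun A : Finset ι => A.subtype (· ∈ s)) '' C) := by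
    rintro _ ⟨A, hA, rfl⟩ _ ⟨A', hA', rfl⟩ _
    rcases hC.total hA hA' with h | h
    · exact Or.inl (Finset.subtype_mono h)
    · exact Or.inr (Finset.subtype_mono h)
  have key := levy_chain_inequality (X := fun i : s => X i) (fun i => hX i)
    (hind.precomp Subtype.val_injective) (fun i => hsymm i) hC' t
  have e1 : {ω | ∃ A ∈ (fun A : Finset ι => A.subtype (· ∈ s)) '' C, t < ‖∑ i ∈ A, X i ω‖}
      = {ω | ∃ A ∈ C, t < ‖∑ i ∈ A, X i ω‖} := by
    ext ω
    simp only [Set.mem_ofPred_eq, Set.exists_mem_image]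
    refine exists_congr fun A => and_congr_right fun hA => ?_
    rw [Finset.sum_subtype_of_mem (fun i => X i ω) (hCs A hA)]
  have e2 : ∀ ω, ∑ i : s, X i ω = ∑ i ∈ s, X i ω := fun ω =>
    Finset.sum_coe_sort s fun i => X i ω
  simp only [e2] at key
  exact e1 ▸ key

theorem contraction_inequality_finset [CompleteSpace B] (hX : ∀ i, Measurable (X i))
    (hind : iIndepFun X P) (hsymm : ∀ i, IdentDistrib (fun ω => -X i ω) (X i) P P) (s : Finset ι)
    {θ : ι → B → ℝ} {v : ι → B → B}
    (hθ : ∀ i, Measurable (θ i)) (h0 : ∀ i ∈ s, ∀ x, 0 ≤ θ i x) (h1 : ∀ i ∈ s, ∀ x, θ i x ≤ 1)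
    (heven : ∀ i x, θ i (-x) = θ i x) (hv : ∀ i, Measurable (v i))
    (hodd : ∀ i x, v i (-x) = -v i x) (t : ℝ) :
    P {ω | t < ‖∑ i ∈ s, θ i (X i ω) • v i (X i ω)‖} ≤
      2 * P {ω | t < ‖∑ i ∈ s, v i (X i ω)‖} := by
  have key := contraction_inequality (X := fun i : s => X i) (θ := fun i : s => θ i)
    (v := fun i : s => v i) (fun i => hX i)
    (hind.precomp Subtype.val_injective) (fun i => hsymm i) (fun i => hθ i)
    (fun i => h0 i i.2) (fun i => h1 i i.2) (fun i => heven i) (fun i => hv i) (fun i => hodd i) t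
  have e1 : ∀ ω, ∑ i : s, θ i (X i ω) • v i (X i ω) = ∑ i ∈ s, θ i (X i ω) • v i (X i ω) :=
    fun ω => Finset.sum_coe_sort s fun i => θ i (X i ω) • v i (X i ω)
  have e2 : ∀ ω, ∑ i : s, v i (X i ω) = ∑ i ∈ s, v i (X i ω) := fun ω =>
    Finset.sum_coe_sort s fun i => v i (X i ω)
  simpa only [e1, e2] using key

/-- A single set is already a chain. -/
theorem levy_subset_inequality (hX : ∀ i, Measurable (X i)) (hind : iIndepFun X P)
    (hsymm : ∀ i, IdentDistrib (fun ω => -X i ω) (X i) P P) {A s : Finset ι} (hA : A ⊆ s) (t : ℝ) :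
    P {ω | t < ‖∑ i ∈ A, X i ω‖} ≤ 2 * P {ω | t < ‖∑ i ∈ s, X i ω‖} := by
  simpa using levy_chain_inequality_finset hX hind hsymm s (C := {A})
    (Set.subsingleton_singleton.isChain) (by simpa using hA) t

end SymmetricFinset

/-! ### Lévy's maximal inequality and the Hoffmann-Jørgensen bound. -/

section HoffmannJorgensen

variable {Ω B : Type*} [MeasurableSpace Ω] {P : Measure Ω}
  [NormedAddCommGroup B] [NormedSpace ℝ B] [MeasurableSpace B] [BorelSpace B]
  [SecondCountableTopology B] {X : ℕ → Ω → B}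

theorem levy_maximal_inequality (hX : ∀ i, Measurable (X i)) (hind : iIndepFun X P)
    (hsymm : ∀ i, IdentDistrib (fun ω => -X i ω) (X i) P P) (s : Finset ℕ) (t : ℝ) :
    P {ω | ∃ k, t < ‖∑ i ∈ s.filter (· < k), X i ω‖} ≤ 2 * P {ω | t < ‖∑ i ∈ s, X i ω‖} := by
  have hC : IsChain (· ⊆ ·) (Set.range fun k : ℕ => s.filter (· < k)) := by
    rintro _ ⟨k, rfl⟩ _ ⟨l, rfl⟩ _
    rcases le_total k l with h | h
    · exact Or.inl (Finset.monotone_filter_right _ fun i _ hi => lt_of_lt_of_le hi h)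
    · exact Or.inr (Finset.monotone_filter_right _ fun i _ hi => lt_of_lt_of_le hi h)
  have key := levy_chain_inequality_finset hX hind hsymm s hC
    (by rintro _ ⟨k, rfl⟩; exact Finset.filter_subset _ _) t
  simpa using key

/-- The Hoffmann-Jørgensen inequality for bounded independent symmetric random variables. -/
theorem hoffmannJorgensen_inequality (hX : ∀ i, Measurable (X i)) (hind : iIndepFun X P)
    (hsymm : ∀ i, IdentDistrib (fun ω => -X i ω) (X i) P P) {c : ℝ}
    (hc : ∀ i ω, ‖X i ω‖ ≤ c) (n : ℕ) {t : ℝ} (ht : 0 ≤ t) :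
    P {ω | 2 * t + c < ‖∑ i ∈ Finset.range n, X i ω‖} ≤
      4 * P {ω | t < ‖∑ i ∈ Finset.range n, X i ω‖} ^ 2 := by
  set p := P {ω | t < ‖∑ i ∈ Finset.range n, X i ω‖} with hp
  let S : ℕ → Ω → B := fun k ω => ∑ i ∈ Finset.range k, X i ω
  have hSm : ∀ k, Measurable (S k) := fun k => Finset.measurable_sum _ fun i _ => hX i
  -- `T k`: first passage above `t` at time `k`; `D k`: the remaining increment exceeds `t`.
  let T : ℕ → Set Ω := fun k => {ω | t < ‖S k ω‖ ∧ ∀ j < k, ‖S j ω‖ ≤ t}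
  let D : ℕ → Set Ω := fun k => {ω | t < ‖∑ i ∈ Finset.Ico k n, X i ω‖}
  have hTm : ∀ k, MeasurableSet (T k) := fun k => by
    refine (measurableSet_lt measurable_const (hSm k).norm).inter ?_
    have : {ω | ∀ j < k, ‖S j ω‖ ≤ t} = ⋂ j, ⋂ (_ : j < k), {ω | ‖S j ω‖ ≤ t} := by ext; simp
    change MeasurableSet {ω | ∀ j < k, ‖S j ω‖ ≤ t}
    rw [this]
    exact MeasurableSet.iInter fun j => MeasurableSet.iInter fun _ =>
      measurableSet_le (hSm j).norm measurable_const
  have hTdisj : Pairwise (Function.onFun Disjoint T) := by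
    have aux : ∀ i j, i < j → Disjoint (T i) (T j) := fun i j hij =>
      Set.disjoint_left.2 fun ω hi hj => not_lt.2 (hj.2 i hij) hi.1
    intro i j hij
    rcases lt_or_gt_of_ne hij with h | h
    · exact aux i j h
    · exact (aux j i h).symm
  have hcover : {ω | 2 * t + c < ‖S n ω‖} ⊆ ⋃ k ∈ Finset.range (n + 1), T k ∩ D k := by
    intro ω hω
    have hω' : 2 * t + c < ‖S n ω‖ := hω
    have hex : ∃ k, t < ‖S k ω‖ := by
      refine ⟨n, ?_⟩
      have := (norm_nonneg _).trans (hc 0 ω)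
      linarith
    classical
    set k := Nat.find hex with hk
    have hk1 : t < ‖S k ω‖ := Nat.find_spec hex
    have hk2 : ∀ j < k, ‖S j ω‖ ≤ t := fun j hj => not_lt.1 (Nat.find_min hex hj)
    have hkn : k ≤ n := Nat.find_min' hex (by
      have := (norm_nonneg _).trans (hc 0 ω)
      linarith)
    refine Set.mem_biUnion (Finset.mem_coe.2 (Finset.mem_range.2 (Nat.lt_succ_of_le hkn)))
      ⟨⟨hk1, hk2⟩, ?_⟩
    change t < ‖∑ i ∈ Finset.Ico k n, X i ω‖
    have hsplit : S n ω = S k ω + ∑ i ∈ Finset.Ico k n, X i ω :=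
      (Finset.sum_range_add_sum_Ico _ hkn).symm
    -- First passage overshoots by at most one term, leaving more than `t` for the remainder.
    have hSk : ‖S k ω‖ ≤ t + c := by
      rcases Nat.eq_zero_or_pos k with h0 | h0
      · rw [h0] at hk1
        simp [S] at hk1
        linarith
      · obtain ⟨j, hj⟩ : ∃ j, k = j + 1 := ⟨k - 1, by omega⟩
        have h1 : S k ω = S j ω + X j ω := by
          rw [hj]; exact Finset.sum_range_succ _ _
        rw [h1]
        exact (norm_add_le _ _).trans (add_le_add (hk2 j (by omega)) (hc j ω))
    have h2 := norm_add_le (S k ω) (∑ i ∈ Finset.Ico k n, X i ω)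
    rw [← hsplit] at h2
    linarith
  -- `T k` involves only indices below `k`, and `D k` only those from `k` on.
  have hindep : ∀ k, P (T k ∩ D k) = P (T k) * P (D k) := by
    intro k
    have hI := hind.indepFun_finset (Finset.range k) (Finset.Ico k n)
      (Finset.disjoint_left.2 fun i h1 h2 => by
        rw [Finset.mem_range] at h1; rw [Finset.mem_Ico] at h2; omega) hX
    have hsm : ∀ j, Measurable fun y : Finset.range k → B =>
        ∑ i ∈ (Finset.range j).subtype (· ∈ Finset.range k), y i := fun j =>
      Finset.measurable_sum _ fun i _ => measurable_pi_apply i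
    have hse : ∀ j ≤ k, ∀ ω, ∑ i ∈ (Finset.range j).subtype (· ∈ Finset.range k), X i ω = S j ω :=
      fun j hj ω => Finset.sum_subtype_of_mem (fun i => X i ω) fun i hi =>
        Finset.mem_range.2 ((Finset.mem_range.1 hi).trans_le hj)
    have hAm : MeasurableSet {y : Finset.range k → B |
        t < ‖∑ i ∈ (Finset.range k).subtype (· ∈ Finset.range k), y i‖ ∧
        ∀ j < k, ‖∑ i ∈ (Finset.range j).subtype (· ∈ Finset.range k), y i‖ ≤ t} := by
      refine (measurableSet_lt measurable_const (hsm k).norm).inter ?_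
      have : {y : Finset.range k → B | ∀ j < k,
          ‖∑ i ∈ (Finset.range j).subtype (· ∈ Finset.range k), y i‖ ≤ t}
          = ⋂ j, ⋂ (_ : j < k), {y : Finset.range k → B |
          ‖∑ i ∈ (Finset.range j).subtype (· ∈ Finset.range k), y i‖ ≤ t} := by ext; simp
      change MeasurableSet {y : Finset.range k → B | ∀ j < k,
          ‖∑ i ∈ (Finset.range j).subtype (· ∈ Finset.range k), y i‖ ≤ t}
      rw [this]
      exact MeasurableSet.iInter fun j => MeasurableSet.iInter fun _ =>
        measurableSet_le (hsm j).norm measurable_const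
    have hBm : MeasurableSet {y : Finset.Ico k n → B | t < ‖∑ i, y i‖} :=
      measurableSet_lt measurable_const
        (Finset.measurable_sum _ fun i _ => measurable_pi_apply i).norm
    have := hI.measure_inter_preimage_eq_mul _ _ hAm hBm
    have eT : (fun ω (i : Finset.range k) => X i ω) ⁻¹' {y : Finset.range k → B |
        t < ‖∑ i ∈ (Finset.range k).subtype (· ∈ Finset.range k), y i‖ ∧
        ∀ j < k, ‖∑ i ∈ (Finset.range j).subtype (· ∈ Finset.range k), y i‖ ≤ t} = T k := by
      ext ω
      simp only [Set.mem_preimage, Set.mem_ofPred_eq, T, hse k le_rfl ω]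
      refine and_congr_right fun _ => forall₂_congr fun j hj => ?_
      rw [hse j hj.le ω]
    have eD : (fun ω (i : Finset.Ico k n) => X i ω) ⁻¹' {y : Finset.Ico k n → B | t < ‖∑ i, y i‖}
        = D k := by
      ext ω
      simp only [Set.mem_preimage, Set.mem_ofPred_eq, D]
      rw [Finset.sum_coe_sort (Finset.Ico k n) fun i => X i ω]
    rw [eT, eD] at this
    exact this
  have hD : ∀ k, P (D k) ≤ 2 * p := fun k =>
    levy_subset_inequality hX hind hsymm (fun i hi => by
      rw [Finset.mem_Ico] at hi; exact Finset.mem_range.2 hi.2) t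
  have hTsum : ∑ k ∈ Finset.range (n + 1), P (T k) ≤ 2 * p := by
    rw [← measure_biUnion_finset (fun i _ j _ hij => hTdisj hij) fun k _ => hTm k]
    refine le_trans (measure_mono ?_) (levy_maximal_inequality hX hind hsymm (Finset.range n) t)
    intro ω hω
    simp only [Set.mem_iUnion] at hω
    obtain ⟨k, hk, hω⟩ := hω
    refine ⟨k, ?_⟩
    have : (Finset.range n).filter (· < k) = Finset.range k := by
      have := Finset.mem_range.1 hk
      ext i; simp only [Finset.mem_filter, Finset.mem_range]; omega
    rw [this]
    exact hω.1
  calc P {ω | 2 * t + c < ‖S n ω‖} ≤ P (⋃ k ∈ Finset.range (n + 1), T k ∩ D k) :=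
        measure_mono hcover
    _ ≤ ∑ k ∈ Finset.range (n + 1), P (T k ∩ D k) := measure_biUnion_finset_le _ _
    _ ≤ ∑ k ∈ Finset.range (n + 1), P (T k) * (2 * p) :=
        Finset.sum_le_sum fun k _ => by rw [hindep]; gcongr; exact hD k
    _ = (∑ k ∈ Finset.range (n + 1), P (T k)) * (2 * p) := (Finset.sum_mul _ _ _).symm
    _ ≤ 2 * p * (2 * p) := by gcongr
    _ = 4 * p ^ 2 := by ring

/-- The mean norm of a sum of bounded independent symmetric variables is controlled by a
quantile. -/
theorem integral_norm_sum_le_of_tail_le [IsProbabilityMeasure P] (hX : ∀ i, Measurable (X i))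
    (hind : iIndepFun X P)
    (hsymm : ∀ i, IdentDistrib (fun ω => -X i ω) (X i) P P) {c : ℝ}
    (hc : ∀ i ω, ‖X i ω‖ ≤ c) (n : ℕ) {t : ℝ} (ht : 0 ≤ t)
    (hp : 16 * P {ω | t < ‖∑ i ∈ Finset.range n, X i ω‖} ≤ 1) :
    ∫ ω, ‖∑ i ∈ Finset.range n, X i ω‖ ∂P ≤ 2 * c + 4 * t := by
  set f : Ω → ℝ := fun ω => ‖∑ i ∈ Finset.range n, X i ω‖ with hf
  set p := P {ω | t < f ω} with hpdef
  have hfm : Measurable f := (Finset.measurable_sum _ fun i _ => hX i).norm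
  have hf0 : ∀ ω, 0 ≤ f ω := fun ω => norm_nonneg _
  have hc0 : 0 ≤ c := by
    obtain ⟨ω⟩ := nonempty_of_isProbabilityMeasure P
    exact (norm_nonneg _).trans (hc 0 ω)
  have hfb : ∀ ω, f ω ≤ n * c := fun ω => by
    refine (norm_sum_le _ _).trans ((Finset.sum_le_sum fun i _ => hc i ω).trans ?_)
    simp
  have hfi : Integrable f P := (integrable_const (n * c)).mono' hfm.aestronglyMeasurable
    (ae_of_all _ fun ω => by rw [Real.norm_of_nonneg (hf0 ω)]; exact hfb ω)
  -- Chosen so that `u < g` becomes `2 * u + c < f` for positive `u`, the event in the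
  -- Hoffmann-Jørgensen inequality.
  set g : Ω → ℝ := fun ω => max ((f ω - c) / 2) 0 with hg
  have hgm : Measurable g := by fun_prop
  have hg0 : ∀ ω, 0 ≤ g ω := fun ω => le_max_right _ _
  have hfg : ∀ ω, f ω ≤ c + 2 * g ω := fun ω => by
    have := le_max_left ((f ω - c) / 2) 0
    simp only [hg]
    linarith
  set E := ∫⁻ ω, ENNReal.ofReal (f ω) ∂P with hE
  have hEtop : E ≠ ⊤ := by
    rw [hE, ← ofReal_integral_eq_lintegral_ofReal hfi (ae_of_all _ hf0)]
    exact ENNReal.ofReal_ne_top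
  have hgE : ∫⁻ ω, ENNReal.ofReal (g ω) ∂P ≤ ENNReal.ofReal t + 4 * p * E := by
    rw [lintegral_eq_lintegral_meas_lt P (ae_of_all _ hg0) hgm.aemeasurable, hE,
      lintegral_eq_lintegral_meas_lt P (ae_of_all _ hf0) hfm.aemeasurable]
    -- Use the trivial bound 1 up to `t`; beyond it, one factor of the squared probability is at
    -- most `p`.
    have hpt : ∀ u ∈ Set.Ioi (0 : ℝ), P {ω | u < g ω} ≤
        (Set.Ioc 0 t).indicator 1 u + 4 * p * P {ω | u < f ω} := by
      intro u hu
      by_cases hut : u ≤ t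
      · rw [Set.indicator_of_mem (show u ∈ Set.Ioc 0 t from ⟨hu, hut⟩)]
        exact le_add_right prob_le_one
      · have h1 : P {ω | u < g ω} ≤ P {ω | 2 * u + c < f ω} := by
          refine measure_mono fun ω hω => ?_
          simp only [Set.mem_ofPred_eq, hg, lt_max_iff] at hω ⊢
          rcases hω with h | h
          · linarith
          · exact absurd h (not_lt.2 (le_of_lt hu))
        have h2 := hoffmannJorgensen_inequality hX hind hsymm hc n (le_of_lt hu)
        have h3 : P {ω | u < f ω} ≤ p :=
          measure_mono fun ω hω => lt_trans (not_le.1 hut) hω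
        refine le_add_left (h1.trans (h2.trans ?_))
        rw [pow_two, ← mul_assoc]
        gcongr
    have hmeas : Measurable fun u : ℝ => P {ω | u < f ω} :=
      Antitone.measurable fun u v huv => measure_mono fun ω hω => lt_of_le_of_lt huv hω
    calc ∫⁻ u in Set.Ioi (0 : ℝ), P {ω | u < g ω}
        ≤ ∫⁻ u in Set.Ioi (0 : ℝ), ((Set.Ioc 0 t).indicator 1 u + 4 * p * P {ω | u < f ω}) :=
          setLIntegral_mono' measurableSet_Ioi hpt
      _ = (∫⁻ u in Set.Ioi (0 : ℝ), (Set.Ioc 0 t).indicator 1 u)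
          + 4 * p * ∫⁻ u in Set.Ioi (0 : ℝ), P {ω | u < f ω} := by
          rw [lintegral_add_left (measurable_one.indicator measurableSet_Ioc),
            lintegral_const_mul _ hmeas]
      _ ≤ ENNReal.ofReal t + 4 * p * ∫⁻ u in Set.Ioi (0 : ℝ), P {ω | u < f ω} := by
          gcongr
          rw [lintegral_indicator_one measurableSet_Ioc]
          refine (Measure.restrict_apply_le _ _).trans ?_
          simp
  have hmain : E ≤ ENNReal.ofReal c + 2 * (ENNReal.ofReal t + 4 * p * E) := by
    calc E ≤ ∫⁻ ω, (ENNReal.ofReal c + 2 * ENNReal.ofReal (g ω)) ∂P := by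
          refine lintegral_mono fun ω => ?_
          rw [← ENNReal.ofReal_ofNat 2, ← ENNReal.ofReal_mul zero_le_two,
            ← ENNReal.ofReal_add hc0 (mul_nonneg zero_le_two (hg0 ω))]
          exact ENNReal.ofReal_le_ofReal (hfg ω)
      _ = ENNReal.ofReal c + 2 * ∫⁻ ω, ENNReal.ofReal (g ω) ∂P := by
          rw [lintegral_add_left measurable_const, lintegral_const_mul _ hgm.ennreal_ofReal]
          simp
      _ ≤ _ := by gcongr
  have hEr : E.toReal = ∫ ω, f ω ∂P :=
    (integral_eq_lintegral_of_nonneg_ae (ae_of_all _ hf0) hfm.aestronglyMeasurable).symm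
  have hptop : p ≠ ⊤ := measure_ne_top _ _
  have hpr : 16 * p.toReal ≤ 1 := by
    have := ENNReal.toReal_mono ENNReal.one_ne_top hp
    simpa using this
  have hr := ENNReal.toReal_mono (by finiteness) hmain
  rw [ENNReal.toReal_add (by finiteness) (by finiteness), ENNReal.toReal_mul,
    ENNReal.toReal_add (by finiteness) (by finiteness), ENNReal.toReal_mul, ENNReal.toReal_mul,
    ENNReal.toReal_ofReal hc0, ENNReal.toReal_ofReal ht] at hr
  simp only [ENNReal.toReal_ofNat] at hr
  rw [← hEr]
  -- Since `16 * p ≤ 1`, the term `8 * p * E` is at most `E / 2` and is absorbed; this needs `E`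
  -- finite.
  nlinarith [mul_le_mul_of_nonneg_right hpr (ENNReal.toReal_nonneg (a := E))]

end HoffmannJorgensen

/-! ### Deterministic estimates along dyadic blocks. -/

section Deterministic

variable {B : Type*} [NormedAddCommGroup B]

/-- Block boundaries along which `β` grows geometrically. -/
theorem exists_dyadic_blocks {β : ℕ → ℝ} (hmono : Monotone β) (hlim : Tendsto β atTop atTop) :
    ∃ m : ℕ → ℕ, ∀ k i, i < m k ↔ β i < 2 ^ k * β 0 := by
  classical
  have hex : ∀ k : ℕ, ∃ i, 2 ^ k * β 0 ≤ β i := fun k => (hlim.eventually_ge_atTop _).exists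
  refine ⟨fun k => Nat.find (hex k), fun k i => ?_⟩
  rw [Nat.lt_find_iff]
  exact ⟨fun h => not_le.1 (h i le_rfl), fun h j hj => not_le.2 ((hmono hj).trans_lt h)⟩

variable {β : ℕ → ℝ} {m : ℕ → ℕ}

theorem monotone_of_dyadic_blocks (hpos : ∀ n, 0 < β n)
    (hm : ∀ k i, i < m k ↔ β i < 2 ^ k * β 0) : Monotone m := by
  intro k l hkl
  by_contra! h
  have h1 := (hm k (m l)).1 h
  have h2 : ¬ β (m l) < 2 ^ l * β 0 := fun h' => lt_irrefl _ ((hm l (m l)).2 h')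
  have h3 : (2 : ℝ) ^ k * β 0 ≤ 2 ^ l * β 0 :=
    mul_le_mul_of_nonneg_right (pow_le_pow_right₀ one_le_two hkl) (hpos 0).le
  linarith

theorem tendsto_dyadic_blocks (hpos : ∀ n, 0 < β n)
    (hm : ∀ k i, i < m k ↔ β i < 2 ^ k * β 0) : Tendsto m atTop atTop := by
  have hpow : Tendsto (fun k : ℕ => (2 : ℝ) ^ k * β 0) atTop atTop :=
    (tendsto_pow_atTop_atTop_of_one_lt one_lt_two).atTop_mul_const (hpos 0)
  exact tendsto_atTop.2 fun N =>
    (hpow.eventually_gt_atTop (β N)).mono fun k hk => ((hm k N).2 hk).le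

/-- Control of the maxima over dyadic blocks controls the normalised sums. -/
theorem eventually_norm_sum_le_of_blocks (hpos : ∀ n, 0 < β n)
    (hlim : Tendsto β atTop atTop) (hm : ∀ k i, i < m k ↔ β i < 2 ^ k * β 0) {x : ℕ → B}
    (hx : ∀ ε > 0, ∀ᶠ k in atTop, ∀ n,
      ‖∑ i ∈ (Finset.Ico (m k) (m (k + 1))).filter (· < n), x i‖ ≤ ε * (2 ^ k * β 0)) :
    ∀ ε > 0, ∀ᶠ n in atTop, ‖∑ i ∈ Finset.range (n + 1), x i‖ ≤ ε * β n := by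
  intro ε hε
  have hmono := monotone_of_dyadic_blocks hpos hm
  obtain ⟨K, hK⟩ := eventually_atTop.1 (hx (ε / 3) (by positivity))
  -- The geometric sum of the block bounds is dominated by the next power of two.
  have hind : ∀ d n, m K ≤ n → n ≤ m (K + d) →
      ‖∑ i ∈ Finset.Ico (m K) n, x i‖ ≤ ε / 3 * (2 ^ (K + d) * β 0) := by
    intro d
    induction d with
    | zero =>
      intro n h1 h2
      have : n = m K := le_antisymm h2 h1
      have := hpos 0
      subst n
      simp
      positivity
    | succ d ih =>
      intro n h1 h2
      rcases le_total n (m (K + d)) with h | h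
      · refine (ih n h1 h).trans ?_
        have := hpos 0
        gcongr <;> norm_num
      · rw [← Finset.sum_Ico_consecutive _ (hmono (Nat.le_add_right K d)) h]
        have e : Finset.Ico (m (K + d)) n
            = (Finset.Ico (m (K + d)) (m (K + d + 1))).filter (· < n) := by
          rw [← add_assoc] at h2
          ext i
          simp only [Finset.mem_filter, Finset.mem_Ico]
          omega
        have h3 := hK (K + d) (Nat.le_add_right _ _) n
        rw [← e] at h3
        have h4 := ih (m (K + d)) (hmono (Nat.le_add_right K d)) le_rfl
        refine (norm_add_le _ _).trans ((add_le_add h4 h3).trans (le_of_eq ?_))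
        rw [← add_assoc, pow_succ]
        ring
  filter_upwards [eventually_ge_atTop (m K),
    hlim.eventually_ge_atTop (‖∑ i ∈ Finset.range (m K), x i‖ / (ε / 3))] with n hn hn'
  have hex : ∃ d, n < m (K + d) := by
    obtain ⟨k, hk⟩ := ((tendsto_dyadic_blocks hpos hm).eventually_gt_atTop n).exists
    exact ⟨k, hk.trans_le (hmono (Nat.le_add_left k K))⟩
  classical
  obtain ⟨d, hd⟩ : ∃ d, Nat.find hex = d + 1 := by
    refine Nat.exists_eq_succ_of_ne_zero fun h0 => ?_
    have := Nat.find_spec hex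
    rw [h0] at this
    exact absurd hn (not_le.2 this)
  have h1 : n < m (K + (d + 1)) := hd ▸ Nat.find_spec hex
  have h2 : ¬ n < m (K + d) := Nat.find_min hex (by omega)
  -- The block containing `n` starts at this level: the blocks cost at most `2 * ε / 3 * β n`, the
  -- fixed initial sum another third.
  have h3 : 2 ^ (K + d) * β 0 ≤ β n := not_lt.1 fun h => h2 ((hm _ _).2 h)
  have h4 := hind (d + 1) (n + 1) (by omega) h1
  rw [← Finset.sum_range_add_sum_Ico _ (show m K ≤ n + 1 by omega)]
  rw [div_le_iff₀ (by positivity)] at hn'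
  refine (norm_add_le _ _).trans ((add_le_add hn' h4).trans ?_)
  rw [← add_assoc, pow_succ]
  nlinarith

/-- A block sum is a difference of two initial sums. The last index of the block is `m (k + 1) - 1`,
whence the norming. -/
theorem eventually_norm_block_sum_le {α : ℕ → ℝ} (hα : Monotone α) {x : ℕ → B}
    (hmono : Monotone m) (hm : Tendsto m atTop atTop)
    (hx : ∀ ε > 0, ∀ᶠ n in atTop, ‖∑ i ∈ Finset.range (n + 1), x i‖ ≤ ε * α n) :
    ∀ ε > 0, ∀ᶠ k in atTop,
      ‖∑ i ∈ Finset.Ico (m k) (m (k + 1)), x i‖ ≤ ε * α (m (k + 1) - 1) := by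
  intro ε hε
  obtain ⟨N, hN⟩ := eventually_atTop.1 (hx (ε / 2) (by positivity))
  filter_upwards [hm.eventually_ge_atTop (N + 1)] with k hk
  have hle : m k ≤ m (k + 1) := hmono (Nat.le_succ k)
  rw [Finset.sum_Ico_eq_sub _ hle]
  have h1 := hN (m (k + 1) - 1) (by omega)
  have h2 := hN (m k - 1) (by omega)
  rw [Nat.sub_add_cancel (by omega)] at h1 h2
  have h3 : α (m k - 1) ≤ α (m (k + 1) - 1) := hα (by omega)
  refine (norm_sub_le _ _).trans ?_
  nlinarith

/-- Changing finitely many terms adds an eventually constant vector, negligible because `α`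
diverges. -/
theorem eventually_norm_sum_le_congr {α : ℕ → ℝ} (hlim : Tendsto α atTop atTop) {x y : ℕ → B}
    (hxy : ∀ᶠ n in atTop, x n = y n)
    (hx : ∀ ε > 0, ∀ᶠ n in atTop, ‖∑ i ∈ Finset.range (n + 1), x i‖ ≤ ε * α n) :
    ∀ ε > 0, ∀ᶠ n in atTop, ‖∑ i ∈ Finset.range (n + 1), y i‖ ≤ ε * α n := by
  intro ε hε
  obtain ⟨N, hN⟩ := eventually_atTop.1 hxy
  filter_upwards [hx (ε / 2) (by positivity), eventually_ge_atTop N,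
    hlim.eventually_ge_atTop (‖∑ i ∈ Finset.range N, (y i - x i)‖ / (ε / 2))] with n h1 h2 h3
  rw [div_le_iff₀ (by positivity)] at h3
  have h4 : ∑ i ∈ Finset.range (n + 1), y i
      = ∑ i ∈ Finset.range (n + 1), x i + ∑ i ∈ Finset.range N, (y i - x i) := by
    have h5 : ∑ i ∈ Finset.range (n + 1), (y i - x i) = ∑ i ∈ Finset.range N, (y i - x i) := by
      rw [← Finset.sum_range_add_sum_Ico _ (show N ≤ n + 1 by omega), Finset.sum_eq_zero
        (s := Finset.Ico N (n + 1)), add_zero]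
      intro i hi
      rw [hN i (Finset.mem_Ico.1 hi).1, sub_self]
    rw [← h5, ← Finset.sum_add_distrib]
    exact Finset.sum_congr rfl fun i _ => by abel
  rw [h4]
  refine (norm_add_le _ _).trans ?_
  nlinarith

end Deterministic

/-! ### The radial weight comparing the two normalisations. -/

section RatioWeight

/-- `α n / β n` for the least `n` with `r ≤ β n`. -/
noncomputable def ratioWeight (α β : ℕ → ℝ) (r : ℝ) : ℝ :=
  α (sInf {n | r ≤ β n}) / β (sInf {n | r ≤ β n})

variable {α β : ℕ → ℝ}

theorem antitone_ratioWeight (hβlim : Tendsto β atTop atTop)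
    (hratio : Antitone fun n => α n / β n) : Antitone (ratioWeight α β) := by
  intro r s hrs
  refine hratio (Nat.sInf_le ?_)
  have : {n | s ≤ β n}.Nonempty := (hβlim.eventually_ge_atTop s).exists
  exact hrs.trans (Nat.sInf_mem this)

theorem ratioWeight_pos (hα : ∀ n, 0 < α n) (hβ : ∀ n, 0 < β n) (r : ℝ) :
    0 < ratioWeight α β r := div_pos (hα _) (hβ _)

theorem div_le_ratioWeight (hratio : Antitone fun n => α n / β n) {r : ℝ} {n : ℕ}
    (h : r ≤ β n) : α n / β n ≤ ratioWeight α β r :=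
  hratio (Nat.sInf_le h)

/-- At the first index where `β` reaches `r`, the weight times `r` is at most `α` there, hence at
most `α n`. -/
theorem ratioWeight_mul_le (hα : ∀ n, 0 < α n) (hβ : ∀ n, 0 < β n) (hαmono : Monotone α)
    {r : ℝ} {n : ℕ} (h : r ≤ β n) : ratioWeight α β r * r ≤ α n := by
  have h1 : r ≤ β (sInf {n | r ≤ β n}) := Nat.sInf_mem (s := {n | r ≤ β n}) ⟨n, h⟩
  have h2 : α (sInf {n | r ≤ β n}) ≤ α n := hαmono (Nat.sInf_le h)
  refine le_trans ?_ h2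
  rw [ratioWeight, div_mul_eq_mul_div, div_le_iff₀ (hβ _)]
  exact mul_le_mul_of_nonneg_left h1 (hα _).le

end RatioWeight

/-! ### Elementary operations on i.i.d. sequences. -/

section IIDSeq

variable {Ω B : Type*} [MeasurableSpace Ω] {P : Measure Ω} [MeasurableSpace B] {X : ℕ → Ω → B}

theorem IsIIDSeq.comp (hX : IsIIDSeq P X) {f : B → B} (hf : Measurable f) :
    IsIIDSeq P fun n ω => f (X n ω) where
  measurable n := hf.comp (hX.measurable n)
  indep := hX.indep.comp (fun _ => f) fun _ => hf
  identDistrib n := (hX.identDistrib n).comp hf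

theorem IsSymmIIDSeq.comp_odd [Neg B] (hX : IsSymmIIDSeq P X) {f : B → B} (hf : Measurable f)
    (hodd : ∀ x, f (-x) = -f x) : IsSymmIIDSeq P fun n ω => f (X n ω) where
  toIsIIDSeq := hX.toIsIIDSeq.comp hf
  symm := by simpa [Function.comp_def, hodd] using hX.symm.comp hf

variable [NormedAddCommGroup B] [BorelSpace B]

theorem IsIIDSeq.measure_lt_norm_eq (hX : IsIIDSeq P X) (n : ℕ) (t : ℝ) :
    P {ω | t < ‖X n ω‖} = P {ω | t < ‖X 0 ω‖} :=
  (hX.identDistrib n).measure_mem_eq (s := {x | t < ‖x‖})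
    (measurableSet_lt measurable_const measurable_norm)

theorem IsIIDSeq.ae_eventually_norm_le (hX : IsIIDSeq P X)
    {β : ℕ → ℝ} (htail : ∑' n, P {ω | β n < ‖X 0 ω‖} < ⊤) :
    ∀ᵐ ω ∂P, ∀ᶠ n in atTop, ‖X n ω‖ ≤ β n := by
  have h : ∑' n, P {ω | β n < ‖X n ω‖} ≠ ⊤ := by
    simp_rw [fun n => hX.measure_lt_norm_eq n (β n)]
    exact htail.ne
  filter_upwards [ae_eventually_notMem h] with ω hω
  exact hω.mono fun n hn => not_lt.1 hn

theorem IsSymmIIDSeq.identDistrib_neg (hX : IsSymmIIDSeq P X) (n : ℕ) :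
    IdentDistrib (fun ω => -X n ω) (X n) P P :=
  (((hX.identDistrib n).comp measurable_neg).trans hX.symm).trans (hX.identDistrib n).symm

end IIDSeq

/-! ### The comparison for symmetric sequences. -/

section SymmetricSLLN

variable {Ω B : Type*} [MeasurableSpace Ω] {P : Measure Ω} [IsProbabilityMeasure P]
  [NormedAddCommGroup B] [NormedSpace ℝ B] [CompleteSpace B] [SecondCountableTopology B]
  [MeasurableSpace B] [BorelSpace B] {α β : ℕ → ℝ} {X : ℕ → Ω → B}

/-- The strong law for symmetric sequences passes from the normalisation `α` to `β`, when
`β / α` is nondecreasing. -/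
theorem symmetric_slln_comparison (hα : ∀ n, 0 < α n) (hβ : ∀ n, 0 < β n)
    (hαmono : Monotone α) (hβmono : Monotone β) (hαlim : Tendsto α atTop atTop)
    (hβlim : Tendsto β atTop atTop) (hratio : Antitone fun n => α n / β n)
    (hslln : ∀ Y : ℕ → Ω → B, IsSymmIIDSeq P Y → ∑' n, P {ω | α n < ‖Y 0 ω‖} < ⊤ →
      ∀ᵐ ω ∂P, ∀ ε > 0, ∀ᶠ n in atTop, ‖∑ i ∈ Finset.range (n + 1), Y i ω‖ ≤ ε * α n)
    (hX : IsSymmIIDSeq P X) (htail : ∑' n, P {ω | β n < ‖X 0 ω‖} < ⊤) :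
    ∀ᵐ ω ∂P, ∀ ε > 0, ∀ᶠ n in atTop, ‖∑ i ∈ Finset.range (n + 1), X i ω‖ ≤ ε * β n := by
  obtain ⟨m, hm⟩ := exists_dyadic_blocks hβmono hβlim
  have hmmono := monotone_of_dyadic_blocks hβ hm
  have hmlim := tendsto_dyadic_blocks hβ hm
  set g := ratioWeight α β with hg
  have hgm : Measurable g := (antitone_ratioWeight hβlim hratio).measurable
  have hgpos : ∀ r, 0 < g r := ratioWeight_pos hα hβ
  have hsymm := hX.identDistrib_neg
  let φ : B → B := fun x => g ‖x‖ • x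
  have hφm : Measurable φ := (hgm.comp measurable_norm).smul measurable_id
  have hφodd : ∀ x, φ (-x) = -φ x := fun x => by simp [φ]
  let tr : ℕ → B → B := fun i x => if ‖x‖ ≤ β i then x else 0
  have htrm : ∀ i, Measurable (tr i) := fun i =>
    Measurable.ite (measurableSet_le measurable_norm measurable_const) measurable_id
      measurable_const
  have htrodd : ∀ i x, tr i (-x) = -tr i x := fun i x => by
    by_cases h : ‖x‖ ≤ β i <;> simp [tr, h]
  have hφtail : ∑' n, P {ω | α n < ‖φ (X 0 ω)‖} < ⊤ := by
    refine lt_of_le_of_lt (ENNReal.tsum_le_tsum fun n => measure_mono fun ω hω => ?_) htail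
    by_contra hn
    have hle : ‖X 0 ω‖ ≤ β n := not_lt.1 hn
    have h1 : ‖φ (X 0 ω)‖ = g ‖X 0 ω‖ * ‖X 0 ω‖ := by
      simp [φ, norm_smul, abs_of_pos (hgpos _)]
    have h2 : α n < ‖φ (X 0 ω)‖ := hω
    rw [h1] at h2
    exact absurd (ratioWeight_mul_le hα hβ hαmono hle) (not_le.2 h2)
  have hφX := hslln _ (hX.comp_odd hφm hφodd) hφtail
  have hbdd := hX.toIsIIDSeq.ae_eventually_norm_le htail
  -- Almost surely truncation at `β i` alters only finitely many terms.
  have htrφ : ∀ᵐ ω ∂P, ∀ ε > 0, ∀ᶠ k in atTop,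
      ‖∑ i ∈ Finset.Ico (m k) (m (k + 1)), φ (tr i (X i ω))‖ ≤ ε * α (m (k + 1) - 1) := by
    filter_upwards [hφX, hbdd] with ω h1 h2
    refine eventually_norm_block_sum_le hαmono hmmono hmlim ?_
    refine eventually_norm_sum_le_congr hαlim ?_ h1
    exact h2.mono fun n hn => by simp [tr, hn]
  have hfull : ∀ ε > 0, ∑' k, P {ω | ε * α (m (k + 1) - 1) <
      ‖∑ i ∈ Finset.Ico (m k) (m (k + 1)), φ (tr i (X i ω))‖} < ⊤ := by
    intro ε hε
    have hinj : Function.Injective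
        (fun p : Σ k, Finset.Ico (m k) (m (k + 1)) => (p.2 : ℕ)) := by
      rintro ⟨k, i, hi⟩ ⟨l, j, hj⟩ (rfl : i = j)
      rw [Finset.mem_Ico] at hi hj
      have hkl : k = l := by
        rcases lt_trichotomy k l with h | h | h
        · have := hmmono (show k + 1 ≤ l from h); omega
        · exact h
        · have := hmmono (show l + 1 ≤ k from h); omega
      subst hkl
      rfl
    have hgr := iIndepFun_groups hX.measurable hX.indep hinj
    have hsm : ∀ k, MeasurableSet {y : Finset.Ico (m k) (m (k + 1)) → B |
        ε * α (m (k + 1) - 1) < ‖∑ i : Finset.Ico (m k) (m (k + 1)), φ (tr i (y i))‖} := fun k =>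
      measurableSet_lt measurable_const (Finset.measurable_sum _
        fun (i : Finset.Ico (m k) (m (k + 1))) _ =>
          (hφm.comp (htrm i)).comp (measurable_pi_apply i)).norm
    have hIm : ∀ k, Measurable fun ω (j : Finset.Ico (m k) (m (k + 1))) => X j ω := fun k =>
      measurable_pi_lambda _ fun j => hX.measurable j
    have hset := iIndepSet_preimage hgr hIm hsm
    have e : ∀ k, (fun ω (j : Finset.Ico (m k) (m (k + 1))) => X j ω) ⁻¹'
        {y : Finset.Ico (m k) (m (k + 1)) → B |
          ε * α (m (k + 1) - 1) < ‖∑ i : Finset.Ico (m k) (m (k + 1)), φ (tr i (y i))‖}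
        = {ω | ε * α (m (k + 1) - 1) <
            ‖∑ i ∈ Finset.Ico (m k) (m (k + 1)), φ (tr i (X i ω))‖} := by
      intro k
      ext ω
      simp only [Set.mem_preimage, Set.mem_ofPred_eq]
      rw [Finset.sum_coe_sort (Finset.Ico (m k) (m (k + 1))) fun i => φ (tr i (X i ω))]
    simp only [e] at hset
    refine tsum_measure_lt_top_of_ae_eventually_notMem hset
      (fun k => e k ▸ hIm k (hsm k)) (Eventually.frequently ?_)
    filter_upwards [htrφ] with ω hω
    exact (hω ε hε).mono fun k hk => not_lt.2 hk
  have hblock : ∀ ε > 0, ∀ k, P {ω | ∃ n, ε * (2 ^ k * β 0) <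
      ‖∑ i ∈ (Finset.Ico (m k) (m (k + 1))).filter (· < n), tr i (X i ω)‖} ≤
      4 * P {ω | ε / 2 * α (m (k + 1) - 1) <
        ‖∑ i ∈ Finset.Ico (m k) (m (k + 1)), φ (tr i (X i ω))‖} := by
    intro ε hε k
    have hlevy := levy_maximal_inequality (X := fun i ω => tr i (X i ω))
      (fun i => (htrm i).comp (hX.measurable i)) (hX.indep.comp tr htrm)
      (fun i => by simpa [Function.comp_def, htrodd] using (hsymm i).comp (htrm i))
      (Finset.Ico (m k) (m (k + 1))) (ε * (2 ^ k * β 0))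
    refine hlevy.trans ?_
    set N := m (k + 1) - 1 with hN
    rcases Nat.lt_or_ge (m k) (m (k + 1)) with hlt | hge
    · have hNlt : N < m (k + 1) := by omega
      have hβN : β N < 2 ^ (k + 1) * β 0 := (hm _ _).1 hNlt
      -- This weight cancels `g`, turning `φ (tr i x)` into a constant multiple of `tr i x`; it is
      -- at most 1 because `‖tr i x‖ ≤ β N` on the block.
      let θ : ℕ → B → ℝ := fun i x => α N / β N / g ‖tr i x‖
      have hNpos : 0 < α N / β N := div_pos (hα _) (hβ _)
      have hcon := contraction_inequality_finset hX.measurable hX.indep hsymm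
        (Finset.Ico (m k) (m (k + 1))) (θ := θ) (v := fun i x => φ (tr i x))
        (fun i => measurable_const.div (hgm.comp (htrm i).norm))
        (fun i _ x => (div_pos hNpos (hgpos _)).le)
        (fun i hi x => by
          rw [div_le_one (hgpos _)]
          refine div_le_ratioWeight hratio ?_
          have hiN : i ≤ N := by rw [Finset.mem_Ico] at hi; omega
          by_cases h : ‖x‖ ≤ β i
          · simpa [tr, h] using h.trans (hβmono hiN)
          · simpa [tr, h] using (hβ N).le)
        (fun i x => by simp [θ, htrodd])
        (fun i => hφm.comp (htrm i)) (fun i x => by simp [htrodd, hφodd])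
        (ε / 2 * α N)
      have hθ : ∀ i x, θ i x • φ (tr i x) = (α N / β N) • tr i x := fun i x => by
        simp only [θ, φ, smul_smul]
        rw [div_mul_cancel₀ _ (hgpos _).ne']
      simp only [hθ, ← Finset.smul_sum] at hcon
      have hstep : P {ω | ε * (2 ^ k * β 0) <
            ‖∑ i ∈ Finset.Ico (m k) (m (k + 1)), tr i (X i ω)‖} ≤
          P {ω | ε / 2 * α N <
            ‖(α N / β N) • ∑ i ∈ Finset.Ico (m k) (m (k + 1)), tr i (X i ω)‖} := by
        refine measure_mono fun ω hω => ?_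
        simp only [Set.mem_ofPred_eq] at hω ⊢
        rw [norm_smul, Real.norm_of_nonneg hNpos.le]
        -- The factor 1/2 pays for `β N < 2 ^ (k + 1) * β 0`.
        have h1 : ε / 2 * β N < ‖∑ i ∈ Finset.Ico (m k) (m (k + 1)), tr i (X i ω)‖ := by
          refine lt_of_le_of_lt ?_ hω
          rw [pow_succ] at hβN
          nlinarith
        have h2 : ε / 2 * α N = α N / β N * (ε / 2 * β N) := by
          field_simp [(hβ N).ne']
        rw [h2]
        exact mul_lt_mul_of_pos_left h1 hNpos
      calc _ ≤ 2 * (2 * P {ω | ε / 2 * α N <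
              ‖∑ i ∈ Finset.Ico (m k) (m (k + 1)), φ (tr i (X i ω))‖}) := by
            gcongr
            exact hstep.trans hcon
        _ = _ := by ring
    · rw [Finset.Ico_eq_empty_of_le hge]
      have : ¬ ε * (2 ^ k * β 0) < 0 := not_lt.2 (by have := hβ 0; positivity)
      simp [this]
  have htrX : ∀ᵐ ω ∂P, ∀ q : ℕ, ∀ᶠ k in atTop, ∀ n,
      ‖∑ i ∈ (Finset.Ico (m k) (m (k + 1))).filter (· < n), tr i (X i ω)‖ ≤
        1 / ((q : ℝ) + 1) * (2 ^ k * β 0) := by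
    rw [ae_all_iff]
    intro q
    have hq : (0 : ℝ) < 1 / ((q : ℝ) + 1) := by positivity
    have hne : ∑' k, P {ω | ∃ n, 1 / ((q : ℝ) + 1) * (2 ^ k * β 0) <
        ‖∑ i ∈ (Finset.Ico (m k) (m (k + 1))).filter (· < n), tr i (X i ω)‖} ≠ ⊤ := by
      refine ne_top_of_le_ne_top ?_ (ENNReal.tsum_le_tsum fun k => hblock _ hq k)
      rw [ENNReal.tsum_mul_left]
      exact ENNReal.mul_ne_top (by simp) (hfull _ (by positivity)).ne
    filter_upwards [ae_eventually_notMem hne] with ω hω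
    refine hω.mono fun k hk n => not_lt.1 fun h => hk ⟨n, h⟩
  filter_upwards [htrX, hbdd] with ω h1 h2
  refine eventually_norm_sum_le_congr hβlim (x := fun i => tr i (X i ω)) ?_
    (eventually_norm_sum_le_of_blocks hβ hβlim hm ?_)
  · exact h2.mono fun n hn => by simp [tr, hn]
  · intro ε hε
    obtain ⟨q, hq⟩ := exists_nat_one_div_lt hε
    refine (h1 q).mono fun k hk n => (hk n).trans ?_
    have := hβ 0
    gcongr

end SymmetricSLLN

/-! ### Series of extended nonnegative numbers. -/

section Series

theorem tsum_lt_top_of_eventually_le {f g : ℕ → ENNReal} (hf : ∀ n, f n ≠ ⊤)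
    (h : ∀ᶠ n in atTop, f n ≤ g n) (hg : ∑' n, g n < ⊤) : ∑' n, f n < ⊤ := by
  obtain ⟨N, hN⟩ := eventually_atTop.1 h
  rw [← (ENNReal.summable (f := fun n => f (n + N))).sum_add_tsum_nat_add']
  refine ENNReal.add_lt_top.2 ⟨ENNReal.sum_lt_top.2 fun i _ => (hf i).lt_top, ?_⟩
  refine lt_of_le_of_lt (ENNReal.tsum_le_tsum fun n => hN (n + N) (Nat.le_add_left N n)) ?_
  exact lt_of_le_of_lt (ENNReal.tsum_comp_le_tsum_of_injective (add_left_injective N) g) hg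

/-- Olivier's theorem. -/
theorem tendsto_succ_mul_of_antitone_of_tsum {f : ℕ → ENNReal} (hf : Antitone f)
    (hsum : ∑' n, f n ≠ ⊤) : Tendsto (fun n : ℕ => ((n : ENNReal) + 1) * f n) atTop (𝓝 0) := by
  rw [ENNReal.tendsto_atTop_zero]
  intro ε hε
  have hε2 : 0 < ε / 2 := ENNReal.half_pos hε.ne'
  obtain ⟨N, hN⟩ := (ENNReal.tendsto_atTop_zero.1 (ENNReal.tendsto_sum_nat_add f hsum)) _ hε2
  have h0 : Tendsto (fun n => (N : ENNReal) * f n) atTop (𝓝 0) := by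
    simpa using ENNReal.Tendsto.const_mul (ENNReal.tendsto_atTop_zero_of_tsum_ne_top hsum)
      (Or.inr (ENNReal.natCast_ne_top N))
  obtain ⟨M, hM⟩ := (ENNReal.tendsto_atTop_zero.1 h0) _ hε2
  refine ⟨max M N, fun n hn => ?_⟩
  have hNn : N ≤ n := (le_max_right _ _).trans hn
  obtain ⟨d, rfl⟩ := Nat.exists_eq_add_of_le' hNn
  -- The `d + 1` terms from `N` to `d + N` all dominate the last one, and their sum lies in a small
  -- tail.
  have h1 : ((d : ENNReal) + 1) * f (d + N) ≤ ε / 2 := by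
    refine le_trans ?_ (hN N le_rfl)
    refine le_trans ?_ (ENNReal.sum_le_tsum (Finset.range (d + 1)))
    calc ((d : ENNReal) + 1) * f (d + N) = ∑ _k ∈ Finset.range (d + 1), f (d + N) := by simp
      _ ≤ _ := Finset.sum_le_sum fun k hk => hf (by rw [Finset.mem_range] at hk; omega)
  calc (((d + N : ℕ) : ENNReal) + 1) * f (d + N)
      = ((d : ENNReal) + 1) * f (d + N) + N * f (d + N) := by push_cast; ring
    _ ≤ ε / 2 + ε / 2 := add_le_add h1 (hM _ ((le_max_left _ _).trans hn))
    _ = ε := ENNReal.add_halves ε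

end Series

/-! ### Convergence of probabilities and averaging over an independent copy. -/

section Measure

variable {Ω : Type*} [MeasurableSpace Ω] {P : Measure Ω}

theorem tendsto_measure_of_ae_eventually_notMem [IsFiniteMeasure P] {s : ℕ → Set Ω}
    (hs : ∀ n, MeasurableSet (s n)) (h : ∀ᵐ ω ∂P, ∀ᶠ n in atTop, ω ∉ s n) :
    Tendsto (fun n => P (s n)) atTop (𝓝 0) := by
  rw [← measure_empty (μ := P)]
  refine tendsto_measure_of_ae_tendsto_indicator_of_isFiniteMeasure atTop MeasurableSet.empty hs ?_
  filter_upwards [h] with ω hω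
  exact hω.mono fun n hn => by simp [hn]

theorem measurableSet_eventually {s : ℕ → Set Ω} (hs : ∀ n, MeasurableSet (s n)) :
    MeasurableSet {ω | ∀ᶠ n in atTop, ω ∈ s n} := by
  have : {ω | ∀ᶠ n in atTop, ω ∈ s n} = ⋃ N : ℕ, ⋂ n : ℕ, ⋂ _ : N ≤ n, s n := by
    ext ω
    simp [eventually_atTop]
  rw [this]
  exact MeasurableSet.iUnion fun N => MeasurableSet.iInter fun n => MeasurableSet.iInter fun _ =>
    hs n

/-- Averaging over an independent variable does not increase the mean distance. -/
theorem integral_norm_sub_integral_le {B : Type*} [NormedAddCommGroup B] [NormedSpace ℝ B]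
    [CompleteSpace B] [MeasurableSpace B] [BorelSpace B] [SecondCountableTopology B]
    [IsProbabilityMeasure P] {U V : Ω → B} (hU : Measurable U) (hV : Measurable V)
    (hUi : Integrable U P) (hVi : Integrable V P) (hind : IndepFun U V P) :
    ∫ ω, ‖U ω - ∫ ω', V ω' ∂P‖ ∂P ≤ ∫ ω, ‖U ω - V ω‖ ∂P := by
  have hprod := (indepFun_iff_map_prod_eq_prod_map_map hU.aemeasurable hV.aemeasurable).1 hind
  have : IsProbabilityMeasure (P.map U) := Measure.isProbabilityMeasure_map hU.aemeasurable
  have : IsProbabilityMeasure (P.map V) := Measure.isProbabilityMeasure_map hV.aemeasurable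
  have hiU : Integrable (fun u : B => u) (P.map U) :=
    (integrable_map_measure (f := U) measurable_id'.aestronglyMeasurable hU.aemeasurable).2 hUi
  have hiV : Integrable (fun v : B => v) (P.map V) :=
    (integrable_map_measure (f := V) measurable_id'.aestronglyMeasurable hV.aemeasurable).2 hVi
  have hnm : Measurable fun z : B × B => ‖z.1 - z.2‖ := by fun_prop
  have hint : Integrable (fun z : B × B => ‖z.1 - z.2‖) ((P.map U).prod (P.map V)) :=
    ((hiU.comp_fst (P.map V)).sub (hiV.comp_snd (P.map U))).norm
  have e1 : ∫ ω, ‖U ω - V ω‖ ∂P = ∫ u, ∫ v, ‖u - v‖ ∂(P.map V) ∂(P.map U) := by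
    rw [← integral_prod _ hint, ← hprod,
      integral_map (hU.prodMk hV).aemeasurable hnm.aestronglyMeasurable]
  have e2 : ∫ ω', V ω' ∂P = ∫ v, v ∂(P.map V) :=
    (integral_map hV.aemeasurable measurable_id'.aestronglyMeasurable).symm
  have e3 : ∫ ω, ‖U ω - ∫ ω', V ω' ∂P‖ ∂P = ∫ u, ‖u - ∫ v, v ∂(P.map V)‖ ∂(P.map U) := by
    rw [e2]
    exact (integral_map hU.aemeasurable 
      (measurable_id.sub_const _).norm.aestronglyMeasurable).symm
  rw [e1, e3]
  -- After factoring the joint law, this is Jensen's inequality in the second variable.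
  refine integral_mono (hiU.sub (integrable_const _)).norm hint.integral_prod_left fun u => ?_
  have : u - ∫ v, v ∂(P.map V) = ∫ v, (u - v) ∂(P.map V) := by
    rw [integral_sub (integrable_const _) hiV]
    simp
  simp only
  rw [this]
  exact norm_integral_le_integral_norm _

end Measure

/-! ### Symmetrisation by consecutive pairs. -/

section Pairing

variable {Ω B : Type*} [MeasurableSpace Ω] {P : Measure Ω} [MeasurableSpace B] {X : ℕ → Ω → B}

/-- Both laws are the same infinite product; almost sure statements thus transfer to the even and
odd subsequences. -/
theorem IsIIDSeq.map_subseq_eq (hX : IsIIDSeq P X) {e : ℕ → ℕ} (he : Function.Injective e) :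
    P.map (fun ω n => X (e n) ω) = P.map fun ω n => X n ω := by
  rw [(hX.indep.precomp he).map_fun_eq_infinitePi_map fun n => hX.measurable (e n),
    hX.indep.map_fun_eq_infinitePi_map hX.measurable]
  simp_rw [fun n => (hX.identDistrib n).map_eq]

theorem IsIIDSeq.indepFun_even_odd (hX : IsIIDSeq P X) :
    IndepFun (fun ω n => X (2 * n) ω) (fun ω n => X (2 * n + 1) ω) P := by
  have he : Function.Injective fun p : (Σ _ : Bool, ℕ) => 2 * p.2 + p.1.toNat := by
    rintro ⟨b, n⟩ ⟨c, k⟩ h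
    cases b <;> cases c <;> simp at h ⊢ <;> omega
  exact (iIndepFun_groups hX.measurable hX.indep he).indepFun (i := false) (j := true) (by simp)

/-- The differences of consecutive pairs of an i.i.d. sequence. -/
def pairDiff {Ω B : Type*} [Sub B] (X : ℕ → Ω → B) (n : ℕ) (ω : Ω) : B :=
  X (2 * n) ω - X (2 * n + 1) ω

theorem IsIIDSeq.tsum_pairDiff_lt_top [NormedAddCommGroup B] [BorelSpace B]
    (hX : IsIIDSeq P X) {c : ℕ → ℝ}
    (h : ∑' n, P {ω | c n < ‖X 0 ω‖} < ⊤) :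
    ∑' n, P {ω | 2 * c n < ‖pairDiff X 0 ω‖} < ⊤ := by
  refine lt_of_le_of_lt (ENNReal.tsum_le_tsum (g := fun n => 2 * P {ω | c n < ‖X 0 ω‖})
    fun n => ?_) ?_
  · calc P {ω | 2 * c n < ‖pairDiff X 0 ω‖}
        ≤ P ({ω | c n < ‖X 0 ω‖} ∪ {ω | c n < ‖X 1 ω‖}) := by
          refine measure_mono fun ω hω => ?_
          by_contra hn
          simp only [Set.mem_union, Set.mem_ofPred_eq, not_or, not_lt] at hn
          have h1 : 2 * c n < ‖X 0 ω - X 1 ω‖ := hω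
          have h2 := norm_sub_le (X 0 ω) (X 1 ω)
          linarith
      _ ≤ P {ω | c n < ‖X 0 ω‖} + P {ω | c n < ‖X 1 ω‖} := measure_union_le _ _
      _ = 2 * P {ω | c n < ‖X 0 ω‖} := by rw [hX.measure_lt_norm_eq 1, two_mul]
  · rw [ENNReal.tsum_mul_left]
    exact ENNReal.mul_lt_top (by simp) h

variable [IsProbabilityMeasure P]

theorem IsIIDSeq.map_even_odd_eq (hX : IsIIDSeq P X) :
    P.map (fun ω => ((fun n => X (2 * n) ω), fun n => X (2 * n + 1) ω)) =
      (P.map fun ω n => X n ω).prod (P.map fun ω n => X n ω) := by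
  have hU : Measurable fun ω n => X (2 * n) ω := measurable_pi_lambda _ fun n => hX.measurable _
  have hV : Measurable fun ω n => X (2 * n + 1) ω :=
    measurable_pi_lambda _ fun n => hX.measurable _
  rw [(indepFun_iff_map_prod_eq_prod_map_map hU.aemeasurable hV.aemeasurable).1
    hX.indepFun_even_odd,
    hX.map_subseq_eq (e := fun n => 2 * n) fun a b h => by simpa using h,
    hX.map_subseq_eq (e := fun n => 2 * n + 1) fun a b h => by simpa using h]

variable [NormedAddCommGroup B] [BorelSpace B]

/-- Tail series of the differences control those of the original sequence. -/
theorem IsIIDSeq.tsum_lt_top_of_pairDiff (hX : IsIIDSeq P X) {β : ℕ → ℝ}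
    (hβlim : Tendsto β atTop atTop)
    (h : ∀ ε > 0, ∑' n, P {ω | ε * β n < ‖pairDiff X 0 ω‖} < ⊤) {ε : ℝ} (hε : 0 < ε) :
    ∑' n, P {ω | ε * β n < ‖X 0 ω‖} < ⊤ := by
  have hm : ∀ (k : ℕ) (t : ℝ), MeasurableSet {ω | t < ‖X k ω‖} := fun k t =>
    measurableSet_lt measurable_const (hX.measurable k).norm
  have hlim : Tendsto (fun M : ℕ => P {ω | (M : ℝ) < ‖X 1 ω‖}) atTop (𝓝 0) := by
    refine tendsto_measure_of_ae_eventually_notMem (fun M => hm 1 M) (ae_of_all _ fun ω => ?_)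
    filter_upwards [tendsto_natCast_atTop_atTop.eventually_ge_atTop ‖X 1 ω‖] with M hM
    exact not_lt.2 hM
  -- `M` is a quantile: the subtracted copy stays within `M` with probability at least 1/2, so
  -- removing it costs a factor 2 and a shift `M`.
  obtain ⟨M, hM⟩ := (hlim.eventually_le_const (u := 2⁻¹) (by simp)).exists
  have hM' : 1 ≤ 2 * P {ω | ‖X 1 ω‖ ≤ (M : ℝ)} := by
    have h1 : P {ω | ‖X 1 ω‖ ≤ (M : ℝ)} = 1 - P {ω | (M : ℝ) < ‖X 1 ω‖} := by
      rw [← prob_compl_eq_one_sub (hm 1 M)]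
      congr 1
      ext ω
      simp
    have h2 : (2 : ENNReal)⁻¹ ≤ P {ω | ‖X 1 ω‖ ≤ (M : ℝ)} := by
      rw [h1, ← ENNReal.one_sub_inv_two]
      exact tsub_le_tsub_left hM 1
    calc (1 : ENNReal) = 2 * 2⁻¹ := (ENNReal.mul_inv_cancel (by simp) (by simp)).symm
      _ ≤ _ := by gcongr
  have hkey : ∀ t : ℝ, P {ω | t + M < ‖X 0 ω‖} ≤ 2 * P {ω | t < ‖pairDiff X 0 ω‖} := by
    intro t
    have hind : P ({ω | t + M < ‖X 0 ω‖} ∩ {ω | ‖X 1 ω‖ ≤ (M : ℝ)})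
        = P {ω | t + M < ‖X 0 ω‖} * P {ω | ‖X 1 ω‖ ≤ (M : ℝ)} :=
      (hX.indep.indepFun zero_ne_one).measure_inter_preimage_eq_mul
        {x | t + M < ‖x‖} {x | ‖x‖ ≤ (M : ℝ)}
        (measurableSet_lt measurable_const measurable_norm)
        (measurableSet_le measurable_norm measurable_const)
    have hsub : {ω | t + M < ‖X 0 ω‖} ∩ {ω | ‖X 1 ω‖ ≤ (M : ℝ)} ⊆
        {ω | t < ‖pairDiff X 0 ω‖} := by
      rintro ω ⟨h1, h2⟩
      simp only [Set.mem_ofPred_eq] at h1 h2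
      change t < ‖X 0 ω - X 1 ω‖
      have := norm_sub_norm_le (X 0 ω) (X 1 ω)
      linarith
    calc P {ω | t + M < ‖X 0 ω‖}
        ≤ P {ω | t + M < ‖X 0 ω‖} * (2 * P {ω | ‖X 1 ω‖ ≤ (M : ℝ)}) :=
          le_mul_of_one_le_right' hM'
      _ = 2 * P ({ω | t + M < ‖X 0 ω‖} ∩ {ω | ‖X 1 ω‖ ≤ (M : ℝ)}) := by rw [hind]; ring
      _ ≤ _ := by gcongr
  refine tsum_lt_top_of_eventually_le (g := fun n => 2 * P {ω | ε / 2 * β n < ‖pairDiff X 0 ω‖})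
    (fun n => measure_ne_top _ _) ?_ ?_
  · filter_upwards [hβlim.eventually_ge_atTop (M / (ε / 2))] with n hn
    rw [div_le_iff₀ (by positivity)] at hn
    refine (measure_mono fun ω hω => ?_).trans (hkey _)
    have h1 : ε * β n < ‖X 0 ω‖ := hω
    change ε / 2 * β n + M < ‖X 0 ω‖
    linarith
  · rw [ENNReal.tsum_mul_left]
    exact ENNReal.mul_lt_top (by simp) (h _ (by positivity))

variable [SecondCountableTopology B]

/-- The right side does not see `i` and `j`: this gives identical distribution of the differences
and, on exchanging the indices, their symmetry. -/
theorem IsIIDSeq.map_sub_eq (hX : IsIIDSeq P X) {i j : ℕ} (hij : i ≠ j) :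
    P.map (fun ω => X i ω - X j ω) =
      ((P.map (X 0)).prod (P.map (X 0))).map fun z => z.1 - z.2 := by
  have h : (P.map (X 0)).prod (P.map (X 0)) = (P.map (X i)).prod (P.map (X j)) := by
    rw [(hX.identDistrib i).map_eq, (hX.identDistrib j).map_eq]
  rw [h, ← (indepFun_iff_map_prod_eq_prod_map_map (hX.measurable i).aemeasurable
    (hX.measurable j).aemeasurable).1 (hX.indep.indepFun hij),
    Measure.map_map (by fun_prop) ((hX.measurable i).prodMk (hX.measurable j))]
  rfl

theorem IsIIDSeq.isSymmIIDSeq_pairDiff (hX : IsIIDSeq P X) : IsSymmIIDSeq P (pairDiff X) where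
  measurable n := (hX.measurable _).sub (hX.measurable _)
  indep := by
    have he : Function.Injective fun p : (Σ _ : ℕ, Bool) => 2 * p.1 + p.2.toNat := by
      rintro ⟨n, b⟩ ⟨k, c⟩ h
      cases b <;> cases c <;> simp at h ⊢ <;> omega
    exact (iIndepFun_groups hX.measurable hX.indep he).comp (fun _ y => y false - y true)
      fun _ => (measurable_pi_apply _).sub (measurable_pi_apply _)
  identDistrib n :=
    ⟨((hX.measurable _).sub (hX.measurable _)).aemeasurable,
      ((hX.measurable _).sub (hX.measurable _)).aemeasurable, by
        unfold pairDiff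
        rw [hX.map_sub_eq (by omega), hX.map_sub_eq (by omega)]⟩
  symm := by
    refine ⟨((hX.measurable _).sub (hX.measurable _)).neg.aemeasurable,
      ((hX.measurable _).sub (hX.measurable _)).aemeasurable, ?_⟩
    unfold pairDiff
    simp only [neg_sub]
    rw [hX.map_sub_eq (by omega), hX.map_sub_eq (by omega)]

end Pairing

/-! ### From one tail level to all levels. -/

section Bootstrap

variable {Ω B : Type*} [MeasurableSpace Ω] {P : Measure Ω} [IsProbabilityMeasure P]
  [NormedAddCommGroup B]
  [MeasurableSpace B] [BorelSpace B] {β : ℕ → ℝ} {X : ℕ → Ω → B}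

/-- If a sequence of terms is eventually bounded by `K β n` with positive probability for some
random `K`, then some tail series converges. -/
theorem IsIIDSeq.exists_tsum_lt_top (hX : IsIIDSeq P X) (hβ : ∀ n, 0 < β n)
    (h : ∃ᵐ ω ∂P, ∃ K : ℕ, ∀ᶠ n in atTop, ‖X n ω‖ ≤ K * β n) :
    ∃ K : ℕ, 0 < K ∧ ∑' n, P {ω | K * β n < ‖X 0 ω‖} < ⊤ := by
  have h1 : ∃ K : ℕ, ∃ᵐ ω ∂P, ∀ᶠ n in atTop, ‖X n ω‖ ≤ K * β n := by
    by_contra hn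
    rw [not_exists] at hn
    have h2 := ae_all_iff.2 fun K => not_frequently.1 (hn K)
    refine h (h2.mono fun ω hω => ?_)
    rintro ⟨K, hK⟩
    exact hω K hK
  obtain ⟨K, hK⟩ := h1
  refine ⟨K + 1, Nat.succ_pos K, ?_⟩
  have hs : ∀ n : ℕ, MeasurableSet {x : B | ((K + 1 : ℕ) : ℝ) * β n < ‖x‖} := fun n =>
    measurableSet_lt measurable_const measurable_norm
  have h3 := tsum_measure_lt_top_of_ae_eventually_notMem
    (iIndepSet_preimage hX.indep hX.measurable hs) (fun n => hX.measurable n (hs n))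
    (hK.mono fun ω hω => hω.mono fun n hn => by
      simp only [Set.mem_preimage, Set.mem_ofPred_eq, not_lt]
      have := hβ n
      push_cast
      linarith)
  refine lt_of_eq_of_lt (tsum_congr fun n => ?_) h3
  exact (hX.measure_lt_norm_eq n _).symm

/-- The conclusion of the strong law is scale invariant, so apply it to `K⁻¹ • X`. Terms are
differences of consecutive sums, hence o(β), and the second Borel-Cantelli lemma returns every tail
level. -/
theorem tsum_lt_top_of_slln [NormedSpace ℝ B] (hβmono : Monotone β)
    (hslln : ∀ Y : ℕ → Ω → B, IsSymmIIDSeq P Y → ∑' n, P {ω | β n < ‖Y 0 ω‖} < ⊤ →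
      ∀ᵐ ω ∂P, ∀ ε > 0, ∀ᶠ n in atTop, ‖∑ i ∈ Finset.range (n + 1), Y i ω‖ ≤ ε * β n)
    (hX : IsSymmIIDSeq P X) {K : ℝ} (hK : 0 < K) (htail : ∑' n, P {ω | K * β n < ‖X 0 ω‖} < ⊤) :
    (∀ᵐ ω ∂P, ∀ ε > 0, ∀ᶠ n in atTop, ‖∑ i ∈ Finset.range (n + 1), X i ω‖ ≤ ε * β n) ∧
      ∀ ε > 0, ∑' n, P {ω | ε * β n < ‖X 0 ω‖} < ⊤ := by
  have hY : IsSymmIIDSeq P fun n ω => K⁻¹ • X n ω :=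
    hX.comp_odd (measurable_const_smul K⁻¹) fun x => smul_neg _ _
  have hnorm : ∀ x : B, ‖K⁻¹ • x‖ = K⁻¹ * ‖x‖ := fun x => by
    rw [norm_smul, Real.norm_of_nonneg (by positivity)]
  have h1 := hslln _ hY (by simpa only [hnorm, lt_inv_mul_iff₀ hK] using htail)
  have h2 : ∀ᵐ ω ∂P, ∀ ε > 0, ∀ᶠ n in atTop,
      ‖∑ i ∈ Finset.range (n + 1), X i ω‖ ≤ ε * β n := by
    filter_upwards [h1] with ω hω ε hε
    refine (hω (ε / K) (by positivity)).mono fun n hn => ?_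
    rw [← Finset.smul_sum, hnorm, inv_mul_le_iff₀ hK] at hn
    refine hn.trans (le_of_eq ?_)
    field_simp
  refine ⟨h2, fun ε hε => ?_⟩
  have hs : ∀ n : ℕ, MeasurableSet {x : B | ε * β n < ‖x‖} := fun n =>
    measurableSet_lt measurable_const measurable_norm
  have h3 := tsum_measure_lt_top_of_ae_eventually_notMem
    (iIndepSet_preimage hX.indep hX.measurable hs) (fun n => hX.measurable n (hs n))
    (Eventually.frequently (h2.mono fun ω hω => by
      obtain ⟨N, hN⟩ := eventually_atTop.1 (hω (ε / 2) (by positivity))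
      filter_upwards [eventually_ge_atTop (N + 1)] with n hn
      obtain ⟨k, rfl⟩ : ∃ k, n = k + 1 := ⟨n - 1, by omega⟩
      simp only [Set.mem_preimage, Set.mem_ofPred_eq, not_lt]
      have e : X (k + 1) ω = ∑ i ∈ Finset.range (k + 1 + 1), X i ω
          - ∑ i ∈ Finset.range (k + 1), X i ω := by
        rw [Finset.sum_range_succ _ (k + 1)]; abel
      rw [e]
      have i1 := hN k (by omega)
      have i2 := hN (k + 1) (by omega)
      have i3 : β k ≤ β (k + 1) := hβmono (Nat.le_succ k)
      refine (norm_sub_le _ _).trans ?_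
      nlinarith))
  refine lt_of_eq_of_lt (tsum_congr fun n => ?_) h3
  exact (hX.toIsIIDSeq.measure_lt_norm_eq n _).symm

end Bootstrap

/-! ### Truncation by norm. -/

section Truncation

variable {B : Type*} [NormedAddCommGroup B]

/-- Truncation at level `r`. -/
noncomputable def normTrunc (r : ℝ) (x : B) : B := if ‖x‖ ≤ r then x else 0

theorem normTrunc_of_le {r : ℝ} {x : B} (h : ‖x‖ ≤ r) : normTrunc r x = x := if_pos h

theorem norm_normTrunc_le {r : ℝ} (hr : 0 ≤ r) (x : B) : ‖normTrunc r x‖ ≤ r := by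
  unfold normTrunc
  split_ifs with h
  · exact h
  · simpa using hr

theorem norm_normTrunc_sub_le {r s : ℝ} (hrs : r ≤ s) (hs : 0 ≤ s) (x : B) :
    ‖normTrunc s x - normTrunc r x‖ ≤ {x : B | r < ‖x‖}.indicator (fun _ => s) x := by
  by_cases h : ‖x‖ ≤ r
  · have h' : x ∉ {x : B | r < ‖x‖} := not_lt.2 h
    rw [Set.indicator_of_notMem h', normTrunc_of_le h, normTrunc_of_le (h.trans hrs)]
    simp
  · have h' : x ∈ {x : B | r < ‖x‖} := not_le.1 h
    rw [Set.indicator_of_mem h', normTrunc, normTrunc, if_neg h, sub_zero]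
    exact norm_normTrunc_le hs x

theorem measurable_normTrunc [MeasurableSpace B] [BorelSpace B] (r : ℝ) :
    Measurable (normTrunc (B := B) r) :=
  Measurable.ite (measurableSet_le measurable_norm measurable_const) measurable_id measurable_const

end Truncation

/-! ### Deterministic centers and their identification with truncated means. -/

section Centering

variable {Ω B : Type*} [MeasurableSpace Ω] {P : Measure Ω} [IsProbabilityMeasure P]
  [NormedAddCommGroup B] [SecondCountableTopology B]
  [MeasurableSpace B] [BorelSpace B] {β : ℕ → ℝ} {X : ℕ → Ω → B}

theorem integrable_normTrunc {Y : Ω → B} (hY : Measurable Y) {r : ℝ} (hr : 0 ≤ r) :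
    Integrable (fun ω => normTrunc r (Y ω)) P :=
  (integrable_const r).mono' ((measurable_normTrunc r).comp hY).aestronglyMeasurable
    (ae_of_all _ fun ω => norm_normTrunc_le hr (Y ω))

/-- If the symmetrised sums are `o(β n)` almost surely, then the sums are `o(β n)` almost surely
after subtracting suitable constants. -/
theorem exists_center_of_pairDiff (hX : IsIIDSeq P X) (hβ : ∀ n, 0 < β n)
    (hZ : ∀ᵐ ω ∂P, ∀ ε > 0, ∀ᶠ n in atTop,
      ‖∑ i ∈ Finset.range (n + 1), pairDiff X i ω‖ ≤ ε * β n) :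
    ∃ c : ℕ → B, ∀ e : ℕ → ℕ, Function.Injective e → ∀ᵐ ω ∂P, ∀ ε > 0, ∀ᶠ n in atTop,
      ‖∑ i ∈ Finset.range (n + 1), X (e i) ω - c n‖ ≤ ε * β n := by
  set ν := P.map fun ω n => X n ω with hν
  have hXm : ∀ e : ℕ → ℕ, Measurable fun ω n => X (e n) ω := fun e =>
    measurable_pi_lambda _ fun n => hX.measurable _
  have : IsProbabilityMeasure ν := Measure.isProbabilityMeasure_map (hXm fun n => n).aemeasurable
  have hmS : ∀ n : ℕ, Measurable fun x : ℕ → B => ∑ i ∈ Finset.range n, x i := fun n =>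
    Finset.measurable_sum _ fun i _ => measurable_pi_apply i
  have hq : ∀ (y : ℕ → B) , (∀ q : ℕ, ∀ᶠ n in atTop, ‖y n‖ ≤ 1 / ((q : ℝ) + 1) * β n) →
      ∀ ε > 0, ∀ᶠ n in atTop, ‖y n‖ ≤ ε * β n := by
    intro y hy ε hε
    obtain ⟨q, hq⟩ := exists_nat_one_div_lt hε
    refine (hy q).mono fun n hn => hn.trans ?_
    have := (hβ n).le
    gcongr
  have hprod : ∀ᵐ z : (ℕ → B) × (ℕ → B) ∂ν.prod ν, ∀ q : ℕ, ∀ᶠ n in atTop,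
      ‖∑ i ∈ Finset.range (n + 1), z.1 i - ∑ i ∈ Finset.range (n + 1), z.2 i‖ ≤
        1 / ((q : ℝ) + 1) * β n := by
    rw [← hX.map_even_odd_eq, ae_all_iff]
    intro q
    refine (ae_map_iff ((hXm fun n => 2 * n).prodMk (hXm fun n => 2 * n + 1)).aemeasurable
      (measurableSet_eventually (s := fun n => {z : (ℕ → B) × (ℕ → B) |
        ‖∑ i ∈ Finset.range (n + 1), z.1 i - ∑ i ∈ Finset.range (n + 1), z.2 i‖ ≤
          1 / ((q : ℝ) + 1) * β n}) fun n => measurableSet_le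
        (((hmS _).comp measurable_fst).sub ((hmS _).comp measurable_snd)).norm measurable_const)).2 ?_
    filter_upwards [hZ] with ω hω
    refine (hω (1 / ((q : ℝ) + 1)) (by positivity)).mono fun n hn => ?_
    simpa only [pairDiff, Finset.sum_sub_distrib] using hn
  -- Fubini: freeze one realisation `x` of the second copy; its partial sums are the centers.
  obtain ⟨x, hx⟩ := (Measure.ae_ae_of_ae_prod hprod).exists
  refine ⟨fun n => ∑ i ∈ Finset.range (n + 1), x i, fun e he => ?_⟩
  rw [hν, ← hX.map_subseq_eq he] at hx
  filter_upwards [ae_of_ae_map (hXm e).aemeasurable hx] with ω hω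
  refine hq _ fun q => (hω q).mono fun n hn => ?_
  rwa [norm_sub_rev]

variable [NormedSpace ℝ B]

/-- Truncated sums are close to their mean, in mean norm, if the symmetrised sums are small in
probability. -/
theorem integral_norm_sum_normTrunc_sub_le [CompleteSpace B] (hX : IsIIDSeq P X) {r : ℝ}
    (hr : 0 ≤ r) (n : ℕ)
    (h : 16 * (P {ω | r < ‖∑ i ∈ Finset.range n, pairDiff X i ω‖} +
      P (⋃ i ∈ Finset.range (2 * n), {ω | r < ‖X i ω‖})) ≤ 1) :
    ∫ ω, ‖∑ i ∈ Finset.range n, normTrunc r (X (2 * i) ω) -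
      (n : ℝ) • ∫ ω, normTrunc r (X 0 ω) ∂P‖ ∂P ≤ 8 * r := by
  let s : (ℕ → B) → B := fun x => ∑ i ∈ Finset.range n, normTrunc r (x i)
  have hs : Measurable s := Finset.measurable_sum _ fun i _ =>
    (measurable_normTrunc r).comp (measurable_pi_apply i : Measurable fun x : ℕ → B => x i)
  have hXm : ∀ e : ℕ → ℕ, Measurable fun ω n => X (e n) ω := fun e =>
    measurable_pi_lambda _ fun n => hX.measurable _
  have hint : ∀ e : ℕ → ℕ, Integrable (fun ω => s fun n => X (e n) ω) P := fun e =>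
    integrable_finsetSum _ fun i _ => integrable_normTrunc (hX.measurable _) hr
  have hsy := (hX.comp (measurable_normTrunc (B := B) r)).isSymmIIDSeq_pairDiff
  have hdiff : ∀ ω, ∑ i ∈ Finset.range n, pairDiff (fun k ω => normTrunc r (X k ω)) i ω
      = (s fun n => X (2 * n) ω) - s fun n => X (2 * n + 1) ω := fun ω =>
    Finset.sum_sub_distrib _ _
  have htail : P {ω | r < ‖∑ i ∈ Finset.range n, pairDiff (fun k ω => normTrunc r (X k ω)) i ω‖} ≤
      P {ω | r < ‖∑ i ∈ Finset.range n, pairDiff X i ω‖} +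
        P (⋃ i ∈ Finset.range (2 * n), {ω | r < ‖X i ω‖}) := by
    refine (measure_mono fun ω hω => ?_).trans (measure_union_le _ _)
    by_contra hn
    rw [Set.mem_union, not_or] at hn
    have hle : ∀ i < 2 * n, ‖X i ω‖ ≤ r := fun i hi => not_lt.1 fun h =>
      hn.2 (Set.mem_biUnion (Finset.mem_coe.2 (Finset.mem_range.2 hi)) h)
    have heq : ∑ i ∈ Finset.range n, pairDiff (fun k ω => normTrunc r (X k ω)) i ω
        = ∑ i ∈ Finset.range n, pairDiff X i ω := by
      refine Finset.sum_congr rfl fun i hi => ?_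
      rw [Finset.mem_range] at hi
      simp only [pairDiff]
      rw [normTrunc_of_le (hle _ (by omega)), normTrunc_of_le (hle _ (by omega))]
    rw [Set.mem_ofPred_eq, heq] at hω
    exact hn.1 hω
  -- Differences of truncated terms are bounded by `2 * r`; with quantile `r` the bound is `2 * (2 *
  -- r) + 4 * r`.
  have hmean := integral_norm_sum_le_of_tail_le hsy.measurable hsy.indep hsy.identDistrib_neg
    (c := 2 * r) (fun i ω => by
      have h1 := norm_normTrunc_le hr (X (2 * i) ω)
      have h2 := norm_normTrunc_le hr (X (2 * i + 1) ω)
      refine (norm_sub_le _ _).trans ?_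
      linarith) n hr (le_trans (by gcongr) h)
  simp only [hdiff] at hmean
  have hodd : ∫ ω, (s fun n => X (2 * n + 1) ω) ∂P = (n : ℝ) • ∫ ω, normTrunc r (X 0 ω) ∂P := by
    have h1 : ∀ k, ∫ ω, normTrunc r (X k ω) ∂P = ∫ ω, normTrunc r (X 0 ω) ∂P :=
      fun k => ((hX.identDistrib k).comp (measurable_normTrunc r)).integral_eq
    simp only [s]
    rw [integral_finsetSum _ fun i _ => integrable_normTrunc (hX.measurable _) hr]
    simp only [h1, Finset.sum_const, Finset.card_range, Nat.cast_smul_eq_nsmul]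
  have hdev := integral_norm_sub_integral_le (hs.comp (hXm fun n => 2 * n))
    (hs.comp (hXm fun n => 2 * n + 1)) (hint fun n => 2 * n) (hint fun n => 2 * n + 1)
    (hX.indepFun_even_odd.comp hs hs)
  simp only [Function.comp_def] at hdev
  rw [hodd] at hdev
  refine hdev.trans (hmean.trans (le_of_eq ?_))
  ring

/-- The centers can be taken to be truncated means. -/
theorem eventually_norm_truncMean_sub_center_le [CompleteSpace B] (hX : IsIIDSeq P X) (hβ : ∀ n, 0 < β n)
    (hβmono : Monotone β) (hβlim : Tendsto β atTop atTop)
    (hZ : ∀ᵐ ω ∂P, ∀ ε > 0, ∀ᶠ n in atTop,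
      ‖∑ i ∈ Finset.range (n + 1), pairDiff X i ω‖ ≤ ε * β n)
    (htail : ∀ ε > 0, ∑' n, P {ω | ε * β n < ‖X 0 ω‖} < ⊤) {c : ℕ → B}
    (hc : ∀ᵐ ω ∂P, ∀ ε > 0, ∀ᶠ n in atTop,
      ‖∑ i ∈ Finset.range (n + 1), X (2 * i) ω - c n‖ ≤ ε * β n) {ε : ℝ} (hε : 0 < ε) :
    ∀ᶠ n in atTop,
      ‖((n + 1 : ℕ) : ℝ) • ∫ ω, normTrunc (ε * β n) (X 0 ω) ∂P - c n‖ ≤ 33 * ε * β n := by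
  have hr : ∀ n, 0 < ε * β n := fun n => mul_pos hε (hβ n)
  have hεmono : Monotone fun n => ε * β n := fun a b h =>
    mul_le_mul_of_nonneg_left (hβmono h) hε.le
  have hεlim : Tendsto (fun n => ε * β n) atTop atTop := hβlim.const_mul_atTop hε
  let S : ℕ → Ω → B := fun n ω => ∑ i ∈ Finset.range (n + 1), X (2 * i) ω
  let T : ℕ → Ω → B := fun n ω => ∑ i ∈ Finset.range (n + 1), normTrunc (ε * β n) (X (2 * i) ω)
  let γ : ℕ → B := fun n => ((n + 1 : ℕ) : ℝ) • ∫ ω, normTrunc (ε * β n) (X 0 ω) ∂P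
  have hSm : ∀ n, Measurable (S n) := fun n => Finset.measurable_sum _ fun i _ => hX.measurable _
  have hTi : ∀ n, Integrable (T n) P := fun n => integrable_finsetSum _ fun i _ =>
    integrable_normTrunc (hX.measurable _) (hr n).le
  let A : ℕ → Set Ω := fun n => {ω | ε * β n < ‖∑ i ∈ Finset.range (n + 1), pairDiff X i ω‖}
  let D : ℕ → Set Ω := fun n => ⋃ i ∈ Finset.range (2 * (n + 1)), {ω | ε * β n < ‖X i ω‖}
  let C : ℕ → Set Ω := fun n => {ω | ε * β n < ‖S n ω - c n‖}
  have hAlim : Tendsto (fun n => P (A n)) atTop (𝓝 0) :=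
    tendsto_measure_of_ae_eventually_notMem
      (fun n => measurableSet_lt measurable_const (Finset.measurable_sum _ fun i _ =>
        hX.isSymmIIDSeq_pairDiff.measurable i).norm)
      (hZ.mono fun ω hω => (hω ε hε).mono fun n hn => not_lt.2 hn)
  have hClim : Tendsto (fun n => P (C n)) atTop (𝓝 0) :=
    tendsto_measure_of_ae_eventually_notMem
      (fun n => measurableSet_lt measurable_const ((hSm n).sub_const _).norm)
      (hc.mono fun ω hω => (hω ε hε).mono fun n hn => not_lt.2 hn)
  have hp0 : Tendsto (fun n : ℕ => ((n : ENNReal) + 1) * P {ω | ε * β n < ‖X 0 ω‖}) atTop (𝓝 0) :=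
    tendsto_succ_mul_of_antitone_of_tsum
      (fun a b h => measure_mono fun ω hω => lt_of_le_of_lt (hεmono h) hω) (htail ε hε).ne
  have hDlim : Tendsto (fun n => P (D n)) atTop (𝓝 0) := by
    have h2 : Tendsto (fun n : ℕ => 2 * (((n : ENNReal) + 1) * P {ω | ε * β n < ‖X 0 ω‖}))
        atTop (𝓝 0) := by
      simpa using ENNReal.Tendsto.const_mul hp0 (Or.inr ENNReal.ofNat_ne_top)
    refine tendsto_of_tendsto_of_tendsto_of_le_of_le tendsto_const_nhds h2 (fun _ => zero_le)
      fun n => (measure_biUnion_finset_le _ _).trans ?_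
    simp_rw [fun i => hX.measure_lt_norm_eq i (ε * β n)]
    refine le_of_eq ?_
    simp only [Finset.sum_const, Finset.card_range, nsmul_eq_mul]
    push_cast
    ring
  have hADlim : Tendsto (fun n => 16 * (P (A n) + P (D n))) atTop (𝓝 0) := by
    simpa using ENNReal.Tendsto.const_mul (hAlim.add hDlim) (Or.inr (ENNReal.ofNat_ne_top (n := 16)))
  have hCDlim : Tendsto (fun n => P (C n) + P (D n)) atTop (𝓝 0) := by
    simpa using hClim.add hDlim
  filter_upwards [hADlim.eventually_le_const (u := 1) (by simp),
    hCDlim.eventually_le_const (u := 2⁻¹) (by simp)] with n hAD hCD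
  have hdev : ∫ ω, ‖T n ω - γ n‖ ∂P ≤ 8 * (ε * β n) :=
    integral_norm_sum_normTrunc_sub_le hX (hr n).le (n + 1) hAD
  -- Markov: the mean is at most 8 units, so exceeding 32 has probability at most 1/4.
  have hmarkov : P.real {ω | 32 * (ε * β n) ≤ ‖T n ω - γ n‖} ≤ 1 / 4 := by
    have h := mul_meas_ge_le_integral_of_nonneg (μ := P) (f := fun ω => ‖T n ω - γ n‖)
      (ae_of_all _ fun ω => norm_nonneg _) ((hTi n).sub (integrable_const _)).norm
      (32 * (ε * β n))
    have := hr n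
    by_contra! hlt
    nlinarith
  -- The bad events have total probability at most 3/4. One good point suffices, as the quantity to
  -- bound is deterministic; it yields 32 + 1 = 33.
  have hgood : ∃ ω, ω ∉ {ω | 32 * (ε * β n) ≤ ‖T n ω - γ n‖} ∪ (C n ∪ D n) := by
    by_contra! hall
    have huniv : {ω | 32 * (ε * β n) ≤ ‖T n ω - γ n‖} ∪ (C n ∪ D n) = Set.univ :=
      Set.eq_univ_of_forall hall
    have h1 : P.real (C n ∪ D n) ≤ 1 / 2 := by
      have h := ENNReal.toReal_mono (by simp) ((measure_union_le (C n) (D n)).trans hCD)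
      simpa [Measure.real] using h
    have h2 := measureReal_union_le (μ := P) {ω | 32 * (ε * β n) ≤ ‖T n ω - γ n‖} (C n ∪ D n)
    rw [huniv, probReal_univ] at h2
    linarith
  obtain ⟨ω, hω⟩ := hgood
  simp only [Set.mem_union, not_or] at hω
  obtain ⟨h1, h2, h3⟩ := hω
  have h1' : ‖T n ω - γ n‖ ≤ 32 * (ε * β n) := (not_le.1 h1).le
  have h2' : ‖S n ω - c n‖ ≤ ε * β n := not_lt.1 h2
  have hST : S n ω = T n ω := Finset.sum_congr rfl fun i hi => by
    rw [Finset.mem_range] at hi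
    refine (normTrunc_of_le (not_lt.1 fun h => h3 ?_)).symm
    exact Set.mem_biUnion (Finset.mem_coe.2 (Finset.mem_range.2 (by omega))) h
  change ‖γ n - c n‖ ≤ _
  have e : γ n - c n = (S n ω - c n) - (T n ω - γ n) := by rw [hST]; abel
  rw [e]
  refine (norm_sub_le _ _).trans ?_
  linarith

/-- The level of the truncation in the centering is immaterial. -/
theorem eventually_norm_truncMean_sub_truncMean_le (hX : IsIIDSeq P X) (hβ : ∀ n, 0 < β n)
    (hβmono : Monotone β) (htail : ∀ ε > 0, ∑' n, P {ω | ε * β n < ‖X 0 ω‖} < ⊤)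
    {ε : ℝ} (hε : 0 < ε) (hε1 : ε ≤ 1) :
    ∀ᶠ n in atTop, ‖((n + 1 : ℕ) : ℝ) • ∫ ω, normTrunc (β n) (X 0 ω) ∂P -
      ((n + 1 : ℕ) : ℝ) • ∫ ω, normTrunc (ε * β n) (X 0 ω) ∂P‖ ≤ ε * β n := by
  have hp0 : Tendsto (fun n : ℕ => ((n : ENNReal) + 1) * P {ω | ε * β n < ‖X 0 ω‖}) atTop (𝓝 0) :=
    tendsto_succ_mul_of_antitone_of_tsum
      (fun a b h => measure_mono fun ω hω =>
        lt_of_le_of_lt (mul_le_mul_of_nonneg_left (hβmono h) hε.le) hω) (htail ε hε).ne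
  filter_upwards [hp0.eventually_le_const (u := ENNReal.ofReal ε) (by simpa using hε)] with n hn
  have hle : ε * β n ≤ β n := mul_le_of_le_one_left (hβ n).le hε1
  have hm : MeasurableSet {ω | ε * β n < ‖X 0 ω‖} :=
    measurableSet_lt measurable_const (hX.measurable 0).norm
  have h1 : ‖∫ ω, normTrunc (β n) (X 0 ω) ∂P - ∫ ω, normTrunc (ε * β n) (X 0 ω) ∂P‖ ≤
      P.real {ω | ε * β n < ‖X 0 ω‖} * β n := by
    rw [← integral_sub (integrable_normTrunc (hX.measurable 0) (hβ n).le)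
      (integrable_normTrunc (hX.measurable 0) (mul_pos hε (hβ n)).le)]
    have h2 : ∫ ω, {ω | ε * β n < ‖X 0 ω‖}.indicator (fun _ => β n) ω ∂P
        = P.real {ω | ε * β n < ‖X 0 ω‖} * β n := by
      rw [integral_indicator_const _ hm, smul_eq_mul]
    rw [← h2]
    exact norm_integral_le_of_norm_le ((integrable_const _).indicator hm)
      (ae_of_all _ fun ω => norm_normTrunc_sub_le hle (hβ n).le (X 0 ω))
  have h3 : ((n : ℝ) + 1) * P.real {ω | ε * β n < ‖X 0 ω‖} ≤ ε := by
    have h := ENNReal.toReal_mono ENNReal.ofReal_ne_top hn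
    rw [ENNReal.toReal_ofReal hε.le, ENNReal.toReal_mul] at h
    simpa [Measure.real, ENNReal.toReal_add] using h
  rw [← smul_sub, norm_smul, Real.norm_of_nonneg (by positivity)]
  push_cast
  have := hβ n
  nlinarith

/-- The centered strong law for general i.i.d. sequences. -/
theorem centered_slln [CompleteSpace B] (hX : IsIIDSeq P X) (hβ : ∀ n, 0 < β n)
    (hβmono : Monotone β) (hβlim : Tendsto β atTop atTop)
    (hZ : ∀ᵐ ω ∂P, ∀ ε > 0, ∀ᶠ n in atTop,
      ‖∑ i ∈ Finset.range (n + 1), pairDiff X i ω‖ ≤ ε * β n)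
    (htail : ∀ ε > 0, ∑' n, P {ω | ε * β n < ‖X 0 ω‖} < ⊤) :
    ∀ᵐ ω ∂P, ∀ ε > 0, ∀ᶠ n in atTop, ‖∑ i ∈ Finset.range (n + 1), X i ω -
      ((n + 1 : ℕ) : ℝ) • ∫ ω, normTrunc (β n) (X 0 ω) ∂P‖ ≤ ε * β n := by
  obtain ⟨c, hc⟩ := exists_center_of_pairDiff hX hβ hZ
  filter_upwards [hc (fun n => n) fun _ _ h => h] with ω hω ε hε
  -- 35 = 1 + 33 + 1, from the centered sum, the truncated mean at level `δ`, and the change of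
  -- level.
  set δ := min (ε / 35) 1 with hδ
  have hδ0 : 0 < δ := lt_min (by positivity) one_pos
  have hδε : 35 * δ ≤ ε := by
    have := min_le_left (ε / 35) 1
    linarith
  filter_upwards [hω δ hδ0, eventually_norm_truncMean_sub_center_le hX hβ hβmono hβlim hZ htail
    (hc (fun n => 2 * n) fun a b h => by simpa using h) hδ0,
    eventually_norm_truncMean_sub_truncMean_le hX hβ hβmono htail hδ0 (min_le_right _ _)]
    with n h1 h2 h3
  set s := ∑ i ∈ Finset.range (n + 1), X i ω
  set g := ((n + 1 : ℕ) : ℝ) • ∫ ω, normTrunc (β n) (X 0 ω) ∂P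
  set g' := ((n + 1 : ℕ) : ℝ) • ∫ ω, normTrunc (δ * β n) (X 0 ω) ∂P
  have e : s - g = (s - c n) - (g' - c n) - (g - g') := by abel
  rw [e]
  have i1 := norm_sub_le ((s - c n) - (g' - c n)) (g - g')
  have i2 := norm_sub_le (s - c n) (g' - c n)
  have := hβ n
  nlinarith

end Centering

/-! ### From bounded centered sums to bounded symmetrised terms. -/

section Divergence

variable {Ω B : Type*} [MeasurableSpace Ω] {P : Measure Ω}
  [NormedAddCommGroup B] [SecondCountableTopology B]
  [MeasurableSpace B] [BorelSpace B] {β : ℕ → ℝ} {X : ℕ → Ω → B}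

/-- If the sums, centered in any way, are of order `β n` with positive probability, then so are
the terms of the symmetrised sequence. -/
theorem IsIIDSeq.frequently_norm_pairDiff_le (hX : IsIIDSeq P X) (hβmono : Monotone β) (γ : ℕ → B)
    (h : ∃ᵐ ω ∂P, ∃ K : ℕ, ∀ᶠ n in atTop,
      ‖∑ i ∈ Finset.range (n + 1), X i ω - γ n‖ ≤ K * β n) :
    ∃ᵐ ω ∂P, ∃ K : ℕ, ∀ᶠ n in atTop, ‖pairDiff X n ω‖ ≤ K * β n := by
  have hXm : ∀ e : ℕ → ℕ, Measurable fun ω n => X (e n) ω := fun e =>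
    measurable_pi_lambda _ fun n => hX.measurable _
  let A : Set (ℕ → B) := {x | ∃ K : ℕ, ∀ᶠ n in atTop,
    ‖∑ i ∈ Finset.range (n + 1), x i - γ n‖ ≤ K * β n}
  have hA : MeasurableSet A := by
    have : A = ⋃ K : ℕ, {x | ∀ᶠ n in atTop,
        x ∈ {x : ℕ → B | ‖∑ i ∈ Finset.range (n + 1), x i - γ n‖ ≤ K * β n}} := by
      ext x
      simp [A]
    rw [this]
    exact MeasurableSet.iUnion fun K => measurableSet_eventually fun n => measurableSet_le
      ((Finset.measurable_sum _ fun i _ => measurable_pi_apply i).sub_const _).norm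
      measurable_const
  have hpos : ∀ e : ℕ → ℕ, Function.Injective e → P ((fun ω n => X (e n) ω) ⁻¹' A) ≠ 0 := by
    intro e he
    rw [← Measure.map_apply (hXm e) hA, hX.map_subseq_eq he, Measure.map_apply (hXm fun n => n) hA]
    exact frequently_ae_iff.1 h
  -- Two independent events of positive probability occur together with positive probability.
  have hboth : P ((fun ω n => X (2 * n) ω) ⁻¹' A ∩ (fun ω n => X (2 * n + 1) ω) ⁻¹' A) ≠ 0 := by
    rw [hX.indepFun_even_odd.measure_inter_preimage_eq_mul _ _ hA hA]
    exact mul_ne_zero (hpos (fun n => 2 * n) fun a b h => by simpa using h)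
      (hpos (fun n => 2 * n + 1) fun a b h => by simpa using h)
  refine (frequently_ae_iff.2 hboth).mono ?_
  rintro ω ⟨⟨K, hK⟩, ⟨L, hL⟩⟩
  refine ⟨2 * (K + L), ?_⟩
  obtain ⟨N, hN⟩ := eventually_atTop.1 (hK.and hL)
  have hsum : ∀ n ≥ N, ‖∑ i ∈ Finset.range (n + 1), pairDiff X i ω‖ ≤ (K + L) * β n := by
    intro n hn
    obtain ⟨h1, h2⟩ := hN n hn
    have e : ∑ i ∈ Finset.range (n + 1), pairDiff X i ω
        = (∑ i ∈ Finset.range (n + 1), X (2 * i) ω - γ n)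
          - (∑ i ∈ Finset.range (n + 1), X (2 * i + 1) ω - γ n) := by
      simp only [pairDiff, Finset.sum_sub_distrib]
      abel
    rw [e]
    refine (norm_sub_le _ _).trans ((add_le_add h1 h2).trans (le_of_eq ?_))
    ring
  filter_upwards [eventually_ge_atTop (N + 1)] with n hn
  obtain ⟨k, rfl⟩ : ∃ k, n = k + 1 := ⟨n - 1, by omega⟩
  have e : pairDiff X (k + 1) ω = ∑ i ∈ Finset.range (k + 1 + 1), pairDiff X i ω
      - ∑ i ∈ Finset.range (k + 1), pairDiff X i ω := by
    rw [Finset.sum_range_succ _ (k + 1)]; abel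
  rw [e]
  have i1 := hsum k (by omega)
  have i2 := hsum (k + 1) (by omega)
  have i3 : ((K : ℝ) + L) * β k ≤ (K + L) * β (k + 1) :=
    mul_le_mul_of_nonneg_left (hβmono (Nat.le_succ k)) (by positivity)
  refine (norm_sub_le _ _).trans ?_
  push_cast
  linarith

end Divergence

/-! ### Reformulations of the limits. -/

section Tendsto

theorem tendsto_inv_smul_iff_forall_norm_le {B : Type*} [NormedAddCommGroup B] [NormedSpace ℝ B]
    {b : ℕ → ℝ} (hb : ∀ n, 1 ≤ n → 0 < b n) (s : ℕ → B) :
    Tendsto (fun n => (b n)⁻¹ • s n) atTop (𝓝 0) ↔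
      ∀ ε > 0, ∀ᶠ n in atTop, ‖s (n + 1)‖ ≤ ε * b (n + 1) := by
  rw [← tendsto_add_atTop_iff_nat 1, tendsto_zero_iff_norm_tendsto_zero]
  have hnorm : ∀ n, ‖(b (n + 1))⁻¹ • s (n + 1)‖ = ‖s (n + 1)‖ / b (n + 1) := fun n => by
    rw [norm_smul, norm_inv, Real.norm_of_nonneg (hb (n + 1) (by omega)).le, inv_mul_eq_div]
  simp only [hnorm]
  have h0 : ∀ n, 0 ≤ ‖s (n + 1)‖ / b (n + 1) := fun n =>
    div_nonneg (norm_nonneg _) (hb (n + 1) (by omega)).le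
  constructor
  · intro h ε hε
    filter_upwards [h.eventually_le_const hε] with n hn
    rwa [div_le_iff₀ (hb (n + 1) (by omega))] at hn
  · intro h
    rw [tendsto_order]
    refine ⟨fun a ha => Eventually.of_forall fun n => ha.trans_le (h0 n), fun a ha => ?_⟩
    filter_upwards [h (a / 2) (by positivity)] with n hn
    refine lt_of_le_of_lt ((div_le_iff₀ (hb (n + 1) (by omega))).2 hn) (by linarith)

theorem exists_nat_eventually_le_of_limsup_ne_top {f : ℕ → ℝ}
    (h : limsup (fun n => ((f n : ℝ) : EReal)) atTop ≠ ⊤) :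
    ∃ K : ℕ, ∀ᶠ n in atTop, f n ≤ K := by
  obtain ⟨r, hr⟩ := EReal.exists_between_coe_real (lt_top_iff_ne_top.2 h)
  obtain ⟨K, hK⟩ := exists_nat_ge r
  refine ⟨K, (eventually_lt_of_limsup_lt hr.1).mono fun n hn => ?_⟩
  exact (EReal.coe_lt_coe_iff.1 hn).le.trans hK

end Tendsto

/-! ### The comparison theorem. -/

theorem theorem1p2 {Ω B : Type*} [MeasurableSpace Ω] (P : Measure Ω) [IsProbabilityMeasure P]
    [NormedAddCommGroup B] [NormedSpace ℝ B] [CompleteSpace B]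
    [TopologicalSpace.SeparableSpace B] [MeasurableSpace B] [BorelSpace B]
    (a b : ℕ → ℝ)
    (ha_pos : ∀ n, 1 ≤ n → 0 < a n) (hb_pos : ∀ n, 1 ≤ n → 0 < b n)
    (ha_mono : MonotoneOn a (Set.Ici 1)) (hb_mono : MonotoneOn b (Set.Ici 1))
    (ha_lim : Tendsto a atTop atTop)
    (hba_mono : MonotoneOn (fun n => b n / a n) (Set.Ici 1))
    (hsymm : ∀ X : ℕ → Ω → B, IsSymmIIDSeq P X →
      ((∀ᵐ ω ∂P, Tendsto (fun n => (a n)⁻¹ • partialSum X n ω) atTop (𝓝 0)) ↔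
        tailSeries P a X < ⊤)) :
    ∀ X : ℕ → Ω → B, IsIIDSeq P X →
      (tailSeries P b X < ⊤ →
        ∀ᵐ ω ∂P, Tendsto (fun n => (b n)⁻¹ • (partialSum X n ω - truncCenter P b X n))
          atTop (𝓝 0)) ∧
      (tailSeries P b X = ⊤ →
        ∀ᵐ ω ∂P, limsup
          (fun n => ((‖partialSum X n ω - truncCenter P b X n‖ / b n : ℝ) : EReal))
          atTop = ⊤) := by
  have : SecondCountableTopology B := UniformSpace.secondCountable_of_separable B
  -- Shift to indices from 0: `β n` norms the sum of the first `n + 1` terms, and the values at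
  -- index 0 of `a` and `b` never matter.
  set α : ℕ → ℝ := fun n => a (n + 1) with hαdef
  set β : ℕ → ℝ := fun n => b (n + 1) with hβdef
  have hα : ∀ n, 0 < α n := fun n => ha_pos _ (by omega)
  have hβ : ∀ n, 0 < β n := fun n => hb_pos _ (by omega)
  have hmem : ∀ n : ℕ, n + 1 ∈ Set.Ici 1 := fun n => Set.mem_Ici.2 (by omega)
  have hαmono : Monotone α := fun m n h => ha_mono (hmem m) (hmem n) (by omega)
  have hβmono : Monotone β := fun m n h => hb_mono (hmem m) (hmem n) (by omega)
  have hβα : Monotone fun n => β n / α n := fun m n h => hba_mono (hmem m) (hmem n) (by omega)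
  have hratio : Antitone fun n => α n / β n := fun m n h => by
    have := inv_anti₀ (div_pos (hβ m) (hα m)) (hβα h)
    simpa only [inv_div] using this
  have hαlim : Tendsto α atTop atTop := ha_lim.comp (tendsto_add_atTop_nat 1)
  have hβlim : Tendsto β atTop atTop := by
    refine tendsto_atTop_mono (fun n => ?_)
      (hαlim.const_mul_atTop (div_pos (hβ 0) (hα 0)))
    exact (le_div_iff₀ (hα n)).1 (hβα (Nat.zero_le n))
  have hsllnβ : ∀ Y : ℕ → Ω → B, IsSymmIIDSeq P Y → ∑' n, P {ω | β n < ‖Y 0 ω‖} < ⊤ →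
      ∀ᵐ ω ∂P, ∀ ε > 0, ∀ᶠ n in atTop, ‖∑ i ∈ Finset.range (n + 1), Y i ω‖ ≤ ε * β n :=
    fun Y hY htail => symmetric_slln_comparison hα hβ hαmono hβmono hαlim hβlim hratio
      (fun Y hY htail => ((hsymm Y hY).2 htail).mono fun ω hω =>
        (tendsto_inv_smul_iff_forall_norm_le ha_pos _).1 hω) hY htail
  intro X hX
  have hpair := hX.isSymmIIDSeq_pairDiff
  -- Both halves pass through this: the first enters with `K = 2`, the second with the `K` given by
  -- Borel-Cantelli.
  have hall : ∀ K : ℝ, 0 < K → ∑' n, P {ω | K * β n < ‖pairDiff X 0 ω‖} < ⊤ →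
      (∀ᵐ ω ∂P, ∀ ε > 0, ∀ᶠ n in atTop,
        ‖∑ i ∈ Finset.range (n + 1), pairDiff X i ω‖ ≤ ε * β n) ∧
      ∀ ε > 0, ∑' n, P {ω | ε * β n < ‖X 0 ω‖} < ⊤ := fun K hK hsum => by
    obtain ⟨h1, h2⟩ := tsum_lt_top_of_slln hβmono hsllnβ hpair hK hsum
    exact ⟨h1, fun ε hε => hX.tsum_lt_top_of_pairDiff hβlim h2 hε⟩
  have hcenter : ∀ n, truncCenter P b X (n + 1)
      = ((n + 1 : ℕ) : ℝ) • ∫ ω, normTrunc (β n) (X 0 ω) ∂P := fun n => by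
    unfold truncCenter normTrunc
    congr 2
  constructor
  · intro htail
    obtain ⟨hZ, hX'⟩ := hall 2 two_pos (hX.tsum_pairDiff_lt_top htail)
    filter_upwards [centered_slln hX hβ hβmono hβlim hZ hX'] with ω hω
    rw [tendsto_inv_smul_iff_forall_norm_le hb_pos]
    simpa only [partialSum, hcenter] using hω
  · intro htail
    by_contra hn
    have hfreq : ∃ᵐ ω ∂P, ∃ K : ℕ, ∀ᶠ n in atTop,
        ‖∑ i ∈ Finset.range (n + 1), X i ω - truncCenter P b X (n + 1)‖ ≤ K * β n := by
      refine (not_eventually.1 hn).mono fun ω hω => ?_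
      obtain ⟨K, hK⟩ := exists_nat_eventually_le_of_limsup_ne_top hω
      refine ⟨K, ((tendsto_add_atTop_nat 1).eventually hK).mono fun n hn => ?_⟩
      exact (div_le_iff₀ (hβ n)).1 hn
    obtain ⟨K, hK, hsum⟩ := hpair.toIsIIDSeq.exists_tsum_lt_top hβ
      (hX.frequently_norm_pairDiff_le hβmono _ hfreq)
    have h1 := (hall K (by exact_mod_cast hK) hsum).2 1 one_pos
    simp only [one_mul] at h1
    exact h1.ne htail
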